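/- **Setting.** For each $N\ge 1$ let $\mathbf Y_N=(Y_1^{(N)},\dots,Y_p^{(N)})$ be a family of random $N\times N$ complex matrices ($p$ fixed). A $^*$-*test graph* $T=(V,E,\gamma,\varepsilon)$ is a finite connected oriented graph with at least one vertex (loops and multiple edges allowed) with maps $\gamma:E\to\{1,\dots,p\}$ and $\varepsilon:E\to\{1,*\}$. It is *cyclic* if there is a closed walk that visits each edge exactly once, in the sense of its orientation. Its trace in $\mathbf Y_N$ is $$\tau_N[T(\mathbf Y_N)]=\frac1N\sum_{\phi:V\to\{1,\dots,N\}}\ \prod_{e=(v,w)\in E}\big(Y^{(N)}_{\gamma(e)}\big)^{\varepsilon(e)}(\phi(v),\phi(w)),$$ where $M(k,l)$ is the $(k,l)$ entry of $M$ and $M^*$ its conjugate transpose. A cutting edge of $T$ is an edge whose removal disconnects $T$. The two-edge connected components of $T$ are the connected components that remain after deletion of all cutting edges. They are the vertices of a tree, in which two distinct components are adjacent when a cutting edge joins them. Let $\mathfrak r(T)$ be the number of leaves (vertices with exactly one neighbor) of this tree, with $\mathfrak r(T)=2$ if the tree has a single vertex. For families whose entries have finite moments of any order (this is part of each assumption),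 consider: - **Assumption 1.** For every cyclic $^*$-test graph $T$, $\lim_{N\to\infty}\mathbb E\big[\tau_N[T(\mathbf Y_N)]\big]$ exists. - **Assumption 2.** For all cyclic $^*$-test graphs $T_1,\dots,T_n$, $\ \mathbb E\big[\prod_{i}\tau_N[T_i(\mathbf Y_N)]\big]-\prod_{i}\mathbb E\big[\tau_N[T_i(\mathbf Y_N)]\big]\to 0$ as $N\to\infty$. - **Assumption 3.** For all (not necessarily cyclic) $^*$-test graphs $T_1,\dots,T_n$, $\ \mathbb E\big[\prod_{i}\tau_N[T_i(\mathbf Y_N)]\big]=O\big(N^{\sum_{i}(\mathfrak r(T_i)/2-1)}\big)$ as $N\to\infty$. **Proposition.** 1. *(Matrices uniformly bounded in operator norm.)* Assume that there is a constant $C$ such that, for all $N$ and $j$, the operator norm of $Y^{(N)}_j$ is almost surely at most $C$. Then there is a subsequence of the sizes $N$ along which $\mathbf Y_N$ satisfies Assumption 1, and $\mathbf Y_N$ satisfies Assumption 3. 2. *(Diagonal matrices.)* Let $\mathbf D_N=(D_1^{(N)},\dots,D_p^{(N)})$ be almost surely diagonal random matrices, whose entries have finite moments of any order, with a limiting $^*$-distribution,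 i.e. $\lim_N\mathbb E\big[\frac1N\mathrm{Tr}[P(\mathbf D_N)]\big]$ exists for every non commutative $^*$-polynomial $P$ in $p$ indeterminates. Assume that for all $^*$-polynomials $P_1,\dots,P_n$, $$\mathbb E\Big[\prod_{i=1}^n\tfrac1N\mathrm{Tr}[P_i(\mathbf D_N)]\Big]-\prod_{i=1}^n\mathbb E\Big[\tfrac1N\mathrm{Tr}[P_i(\mathbf D_N)]\Big]\underset{N\to\infty}\longrightarrow0.$$ Then $\mathbf D_N$ satisfies Assumptions 1, 2 and 3. 3. *(Adjacency matrices of graphs.)* A colored graph on a vertex set $V$ is a family $(E_1,\dots,E_p)$ of subsets of $V\times V$, where $E_j$ is the set of (oriented) edges of color $j$; simple undirected colored graphs are those whose $E_j$ are symmetric and contain no $(v,v)$. Degrees, distances and balls refer to the underlying simple undirected graph (where colors, orientations and loops are forgotten). For each $N$ let $\mathbf G_N$ be a random colored graph on $\{1,\dots,N\}$, and let $Y_j^{(N)}=(\mathbf 1_{(m,n)\in E_j})_{m,n}$ be its adjacency matrices. Assume that for some constant $D$ almost surely all degrees in $\mathbf G_N$ are at most $D$, for all $N$, and that $\mathbf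 G_N$ converges weakly locally to an almost surely locally finite random rooted colored graph $(\mathbf G,o)$: for every $r\ge0$ and every finite rooted colored graph $(H,h)$, the probability that the ball of radius $r$ around $v_N$ in $\mathbf G_N$, rooted at $v_N$, is isomorphic to $(H,h)$ as a rooted colored graph, where $v_N$ is a uniform vertex independent of $\mathbf G_N$, converges to the probability that the ball of radius $r$ around $o$ in $\mathbf G$, rooted at $o$, is isomorphic to $(H,h)$. Then $\mathbf Y_N$ satisfies Assumption 1. Moreover, if $\mathbf Y_N$ satisfies Assumption 2, then it satisfies Assumption 3. -/

import Mathlib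

open MeasureTheory Filter Topology Asymptotics
open scoped Matrix ENNReal

noncomputable section

namespace TrafficModels

/-- The value `A_i` (at `(i, false)`) or `A_i^*` (at `(i, true)`) of the indeterminate
`x_i` or `x_i^*` in a family of square matrices. -/
def starVal {p N : ℕ} (A : Fin p → Matrix (Fin N) (Fin N) ℂ) (x : Fin p × Bool) :
    Matrix (Fin N) (Fin N) ℂ :=
  if x.2 then (A x.1)ᴴ else A x.1

/-! ### Test graphs -/

/-- A `*`-test graph in the variables `x_1, ..., x_p`: a finite, connected, oriented
multigraph (loops and multiple edges allowed) whose edges are labelled by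
`x_1, ..., x_p, x_1^*, ..., x_p^*`. The vertices and the edges are numbered. -/
structure StarTestGraph (p : ℕ) where
  /-- number of vertices -/
  nV : ℕ
  /-- number of edges -/
  nE : ℕ
  /-- source of an edge -/
  src : Fin nE → Fin nV
  /-- target of an edge -/
  tgt : Fin nE → Fin nV
  /-- label of an edge: `(i, false)` is `x_i` and `(i, true)` is `x_i^*` -/
  label : Fin nE → Fin p × Bool
  /-- the underlying undirected graph is connected, in particular there is a vertex -/
  connected : (SimpleGraph.fromRel (fun v w => ∃ e, src e = v ∧ tgt e = w)).Connected

namespace StarTestGraph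

variable {p : ℕ}

/-- Some closed walk visits each edge exactly once, in the sense of its orientation. -/
def IsCyclic (T : StarTestGraph p) : Prop :=
  ∃ σ : Equiv.Perm (Fin T.nE), ∀ k, T.tgt (σ k) = T.src (σ (finRotate T.nE k))

/-- The trace `τ_N[T(A)] = N⁻¹ ∑_{φ : V → {1..N}} ∏_{e = (v,w)} A_{γ(e)}^{ε(e)}(φ v, φ w)`. -/
def trace (T : StarTestGraph p) {N : ℕ} (A : Fin p → Matrix (Fin N) (Fin N) ℂ) : ℂ :=
  (N : ℂ)⁻¹ * ∑ φ : Fin T.nV → Fin N,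
    ∏ e : Fin T.nE, starVal A (T.label e) (φ (T.src e)) (φ (T.tgt e))

/-- The simple undirected graph on the vertices of `T` that the edges in `F` span. -/
def spanBy (T : StarTestGraph p) (F : Set (Fin T.nE)) : SimpleGraph (Fin T.nV) :=
  SimpleGraph.fromRel (fun v w => ∃ e ∈ F, T.src e = v ∧ T.tgt e = w)

/-- A cutting edge: its removal disconnects the graph. -/
def IsCutting (T : StarTestGraph p) (e : Fin T.nE) : Prop :=
  ¬ (T.spanBy {e}ᶜ).Connected

/-- The two-edge connected components of `T`: the connected components of the graph that
is left once all the cutting edges are removed. -/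
abbrev TwoEdgeComp (T : StarTestGraph p) : Type :=
  (T.spanBy {e | ¬ T.IsCutting e}).ConnectedComponent

/-- The two-edge connected component of a vertex. -/
def comp (T : StarTestGraph p) (v : Fin T.nV) : T.TwoEdgeComp :=
  (T.spanBy {e | ¬ T.IsCutting e}).connectedComponentMk v

/-- The tree of two-edge connected components: two distinct components are adjacent when a
cutting edge joins them. -/
def compTree (T : StarTestGraph p) : SimpleGraph T.TwoEdgeComp :=
  SimpleGraph.fromRel
    (fun C C' => ∃ e, T.IsCutting e ∧ T.comp (T.src e) = C ∧ T.comp (T.tgt e) = C')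

open scoped Classical in
/-- The number of leaves of the tree of two-edge connected components, where the tree with
one vertex has two leaves by convention. -/
def leaves (T : StarTestGraph p) : ℕ :=
  if Subsingleton T.TwoEdgeComp then 2
  else Set.ncard {C : T.TwoEdgeComp | (T.compTree.neighborSet C).ncard = 1}

end StarTestGraph

/-! ### Families of random matrices and conditions on their traffics -/

/-- For every `N`, a family of `p` random matrices of size `N`, on a space `Ω N`. -/
abbrev RandomFamily (p : ℕ) (Ω : ℕ → Type*) : Type _ :=
  ∀ N : ℕ, Fin p → Ω N → Matrix (Fin N) (Fin N) ℂ

variable {p : ℕ} {Ω : ℕ → Type*} [∀ N, MeasurableSpace (Ω N)]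

/-- `τ_N[T(Y_N)]` as a random variable. -/
def randTrace (Y : RandomFamily p Ω) (T : StarTestGraph p) (N : ℕ) (ω : Ω N) : ℂ :=
  T.trace (fun j => Y N j ω)

/-- The entries of the matrices of size `N` have finite moments of any order. -/
def FiniteMoments (P : ∀ N, Measure (Ω N)) (Y : RandomFamily p Ω) (N : ℕ) : Prop :=
  ∀ (j : Fin p) (k l : Fin N) (m : ℕ), MemLp (fun ω => Y N j ω k l) (m : ℝ≥0∞) (P N)

/-- Convergence in distribution of traffics on cyclic `*`-test graphs, along the
subsequence `(Y_{φ(n)})`. -/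
def ConvTrafficsAlong (P : ∀ N, Measure (Ω N)) (Y : RandomFamily p Ω) (φ : ℕ → ℕ) : Prop :=
  (∀ n, FiniteMoments P Y (φ n)) ∧
  ∀ T : StarTestGraph p, T.IsCyclic → ∃ τ : ℂ,
    Tendsto (fun n => ∫ ω, randTrace Y T (φ n) ω ∂(P (φ n))) atTop (𝓝 τ)

/-- Convergence in distribution of traffics on cyclic `*`-test graphs. -/
def ConvTraffics (P : ∀ N, Measure (Ω N)) (Y : RandomFamily p Ω) : Prop :=
  ConvTrafficsAlong P Y id

/-- Concentration, for cyclic `*`-test graphs. -/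
def Concentration (P : ∀ N, Measure (Ω N)) (Y : RandomFamily p Ω) : Prop :=
  (∀ N, FiniteMoments P Y N) ∧
  ∀ (n : ℕ) (T : Fin n → StarTestGraph p), (∀ i, (T i).IsCyclic) →
    Tendsto (fun N => (∫ ω, ∏ i, randTrace Y (T i) N ω ∂(P N))
      - ∏ i, ∫ ω, randTrace Y (T i) N ω ∂(P N)) atTop (𝓝 0)

/-- Control of growth, for all `*`-test graphs. -/
def GrowthControl (P : ∀ N, Measure (Ω N)) (Y : RandomFamily p Ω) : Prop :=
  (∀ N, FiniteMoments P Y N) ∧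
  ∀ (n : ℕ) (T : Fin n → StarTestGraph p),
    (fun N => ∫ ω, ∏ i, randTrace Y (T i) N ω ∂(P N)) =O[atTop]
      (fun N : ℕ => (N : ℝ) ^ (∑ i, (((T i).leaves : ℝ) / 2 - 1)))

/-! ### `*`-distributions -/

/-- Non commutative `*`-polynomials in `x_1, ..., x_p`. -/
abbrev StarPoly (p : ℕ) : Type := FreeAlgebra ℂ (Fin p × Bool)

/-- The normalized trace `N⁻¹ Tr[Q(A)]` of a `*`-polynomial in matrices. -/
def polyTrace {N : ℕ} (Q : StarPoly p) (A : Fin p → Matrix (Fin N) (Fin N) ℂ) : ℂ :=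
  (N : ℂ)⁻¹ * (FreeAlgebra.lift ℂ (starVal A) Q).trace

/-- The family has a limiting (mean) `*`-distribution: the entries have all their moments
and the mean normalized traces of all `*`-polynomials converge. -/
def HasLimitStarDistribution (P : ∀ N, Measure (Ω N)) (Y : RandomFamily p Ω) : Prop :=
  (∀ N, FiniteMoments P Y N) ∧
  ∀ Q : StarPoly p, ∃ a : ℂ,
    Tendsto (fun N => ∫ ω, polyTrace Q (fun j => Y N j ω) ∂(P N)) atTop (𝓝 a)

/-! ### Colored graphs and weak local convergence -/

/-- A graph on `V` with edges in `p` colors; `Adj j v w` says that there is an edge of color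
`j` from `v` to `w`. Undirected graphs without loops are those for which each relation `Adj j`
is symmetric and irreflexive. -/
structure ColoredGraph (p : ℕ) (V : Type*) where
  /-- existence of an edge of a given color from a vertex to another one -/
  Adj : Fin p → V → V → Prop

namespace ColoredGraph

variable {V W : Type*}

/-- The underlying simple undirected graph, without colors. -/
def under (G : ColoredGraph p V) : SimpleGraph V :=
  SimpleGraph.fromRel (fun v w => ∃ j, G.Adj j v w)

open scoped Classical in
/-- The adjacency matrices, one for each color. -/
def adjMatrix (G : ColoredGraph p V) (j : Fin p) : Matrix V V ℂ :=
  Matrix.of fun v w => if G.Adj j v w then 1 else 0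

/-- The vertices at graph distance at most `r` from `v`. -/
def ball (G : ColoredGraph p V) (v : V) (r : ℕ) : Set V :=
  {w | G.under.edist v w ≤ (r : ℕ∞)}

/-- The ball of radius `r` around `v`, as a colored graph rooted at `v`, is isomorphic to the
colored graph `H` rooted at `o`. -/
def BallIso (G : ColoredGraph p V) (v : V) (r : ℕ) (H : ColoredGraph p W) (o : W) : Prop :=
  ∃ f : G.ball v r ≃ W, (∀ x : G.ball v r, (x : V) = v → f x = o) ∧
    ∀ (j : Fin p) (x y : G.ball v r), G.Adj j x y ↔ H.Adj j (f x) (f y)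

/-- Every vertex has finitely many neighbors. -/
def IsLocallyFinite (G : ColoredGraph p V) : Prop :=
  ∀ v, (G.under.neighborSet v).Finite

/-- Every vertex has at most `D` neighbors. -/
def DegreeLE (G : ColoredGraph p V) (D : ℕ) : Prop :=
  ∀ v, (G.under.neighborSet v).Finite ∧ (G.under.neighborSet v).ncard ≤ D

end ColoredGraph

/-- A random colored graph on the vertex set `V`. -/
def IsRandomGraph {Ω₀ V : Type*} [MeasurableSpace Ω₀] (G : Ω₀ → ColoredGraph p V) : Prop :=
  ∀ (j : Fin p) (v w : V), MeasurableSet {ω | (G ω).Adj j v w}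

/-- Weak local (Benjamini-Schramm) convergence of random colored graphs `G N` with vertices
`Fin N` to a random rooted colored graph `G₀`, with vertices in `ℕ` and root `0` (the vertices
outside of the connected component of the root play no role): if the root of `G N` is uniform
and independent of `G N`, then for all `r` the law of the isomorphism class of the ball of
radius `r` around the root converges. -/
def WeakLocalConv (P : ∀ N, Measure (Ω N)) (G : ∀ N, Ω N → ColoredGraph p (Fin N))
    {Ω₀ : Type*} [MeasurableSpace Ω₀] (P₀ : Measure Ω₀) (G₀ : Ω₀ → ColoredGraph p ℕ) : Prop :=
  ∀ (r m : ℕ) (H : ColoredGraph p (Fin m)) (o : Fin m),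
    Tendsto (fun N : ℕ => (N : ℝ)⁻¹ * ∑ v : Fin N, (P N).real {ω | (G N ω).BallIso v r H o})
      atTop (𝓝 (P₀.real {ω | (G₀ ω).BallIso 0 r H o}))

end TrafficModels

end

set_option linter.unusedSectionVars false

namespace TrafficModels

/-! The substance of the first part is the sharp Mingo–Speicher bound
`StarTestGraph.norm_sum_prod_sq_le`: for contractions placed on the edges of a connected graph with
`r` leaves in its tree of two-edge connected components, the sum over all labellings of the vertices
is at most `N ^ (r / 2)`. To prove it, attach input and output legs to some vertices and read the
graph as an operator from functions of the input labels to functions of the output labels. If every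
component of the graph meets an input and an output, and both sides of every bridge carry a leg
(`Network.Linked`), this operator is an `ℓ²` contraction (`Network.Linked.isContraction`). The
induction is on the number of vertices plus edges. Either the graph splits at an input vertex into
two linked pieces, and the operator is a composition of contractions; or all legs sit at one vertex,
the operator is diagonal, and removing an edge at that vertex bounds its entries by Cauchy–Schwarz.
One leg per leaf suffices, because each side of a bridge contains a leaf; testing the operator
against constants gives the exponent.

After rescaling, this is Assumption 3 for bounded matrices. A cyclic graph has no bridge, so its
traces are bounded, and compactness of a countable product of discs gives the convergent
subsequence.

For diagonal matrices connectedness leaves only constant labellings, so each graph trace is the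
normalized trace of a monomial.

For graphs of bounded degree, a trace is an average over the vertices of a count that depends only
on a ball of fixed radius, with finitely many possible shapes. Its mean is a finite combination of
ball probabilities, and the trace itself has a deterministic bound. Since `2 ≤ r` always holds, the
exponents in Assumption 3 are nonnegative and bounded moments of traces suffice in the last two
parts. -/

/-! ### Contractions and their tensor products. -/

/-- The matrix and its transpose act as contractions for the `ℓ²` norm. -/
def IsBicontraction {n : Type} [Fintype n] (A : Matrix n n ℂ) : Prop :=
  (∀ f : n → ℂ, ∑ j, ‖∑ i, A i j * f i‖ ^ 2 ≤ ∑ i, ‖f i‖ ^ 2) ∧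
    ∀ f : n → ℂ, ∑ i, ‖∑ j, A i j * f j‖ ^ 2 ≤ ∑ j, ‖f j‖ ^ 2

theorem IsBicontraction.transpose {n : Type} [Fintype n] {A : Matrix n n ℂ}
    (hA : IsBicontraction A) : IsBicontraction Aᵀ :=
  ⟨hA.2, hA.1⟩

theorem IsBicontraction.sum_row_le {n : Type} [Fintype n] [DecidableEq n] {A : Matrix n n ℂ}
    (hA : IsBicontraction A) (i : n) : ∑ j, ‖A i j‖ ^ 2 ≤ 1 := by
  simpa [apply_ite, ite_pow] using hA.1 (fun k => if k = i then 1 else 0)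

theorem IsBicontraction.norm_apply_le {n : Type} [Fintype n] [DecidableEq n] {A : Matrix n n ℂ}
    (hA : IsBicontraction A) (i j : n) : ‖A i j‖ ≤ 1 := by
  have h := (Finset.single_le_sum (f := fun j => ‖A i j‖ ^ 2) (fun _ _ => by positivity)
    (Finset.mem_univ j)).trans (hA.sum_row_le i)
  have h' : ‖A i j‖ ^ 2 ≤ 1 := h
  exact (sq_le_one_iff₀ (norm_nonneg _)).1 h'

/-- The tensor product of contractions is a contraction. -/
theorem tensor_contraction_fin {n : Type} [Fintype n] (m : ℕ) (B : Fin m → Matrix n n ℂ)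
    (hB : ∀ f, IsBicontraction (B f)) (x : (Fin m → n) → ℂ) :
    ∑ k' : Fin m → n, ‖∑ k : Fin m → n, (∏ f, B f (k f) (k' f)) * x k‖ ^ 2
      ≤ ∑ k, ‖x k‖ ^ 2 := by
  induction m with
  | zero => simp
  | succ m ih =>
    rw [← (Fin.consEquiv (fun _ : Fin (m + 1) => n)).sum_comp,
      ← (Fin.consEquiv (fun _ : Fin (m + 1) => n)).sum_comp, Fintype.sum_prod_type,
      Fintype.sum_prod_type]
    -- Factor `0` acts first, on its own coordinate; the other factors then act with that coordinate
    -- frozen.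
    have key : ∀ (j : n) (k' : Fin m → n),
        ∑ k : Fin (m + 1) → n, (∏ f, B f (k f)
          ((Fin.consEquiv (fun _ : Fin (m + 1) => n)) (j, k') f)) * x k
        = ∑ k : Fin m → n, (∏ f, B f.succ (k f) (k' f)) *
            ∑ i, B 0 i j * x (Fin.cons i k : Fin (m + 1) → n) := by
      intro j k'
      rw [← (Fin.consEquiv (fun _ : Fin (m + 1) => n)).sum_comp, Fintype.sum_prod_type,
        Finset.sum_comm]
      refine Finset.sum_congr rfl fun k _ => ?_
      rw [Finset.mul_sum]
      refine Finset.sum_congr rfl fun i _ => ?_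
      have h : Fin.consEquiv (fun _ : Fin (m + 1) => n) (i, k) = Fin.cons i k := rfl
      simp only [h, Fin.consEquiv_apply, Fin.prod_univ_succ, Fin.cons_zero, Fin.cons_succ]
      ring
    simp only [key]
    calc _ ≤ ∑ j, ∑ k : Fin m → n, ‖∑ i, B 0 i j * x (Fin.cons i k : Fin (m + 1) → n)‖ ^ 2 :=
          Finset.sum_le_sum fun j _ => ih (fun f => B f.succ) (fun f => hB _) _
      _ = ∑ k : Fin m → n, ∑ j, ‖∑ i, B 0 i j * x (Fin.cons i k : Fin (m + 1) → n)‖ ^ 2 :=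
          Finset.sum_comm
      _ ≤ ∑ k : Fin m → n, ∑ i, ‖x (Fin.cons i k : Fin (m + 1) → n)‖ ^ 2 :=
          Finset.sum_le_sum fun k _ => (hB 0).1 fun i => x (Fin.cons i k : Fin (m + 1) → n)
      _ = _ := Finset.sum_comm

theorem tensor_contraction {n F : Type} [Fintype n] [Fintype F] [DecidableEq F]
    (B : F → Matrix n n ℂ)
    (hB : ∀ f, IsBicontraction (B f)) (x : (F → n) → ℂ) :
    ∑ k' : F → n, ‖∑ k : F → n, (∏ f, B f (k f) (k' f)) * x k‖ ^ 2 ≤ ∑ k, ‖x k‖ ^ 2 := by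
  let e := Fintype.equivFin F
  have h := tensor_contraction_fin (n := n) _ (fun f => B (e.symm f)) (fun f => hB _)
    (fun k => x (k ∘ e))
  rw [← (Equiv.arrowCongr e (Equiv.refl n)).sum_comp,
    ← (Equiv.arrowCongr e (Equiv.refl n)).sum_comp] at h
  convert h using 3 with k' _ k _
  · rw [← (Equiv.arrowCongr e (Equiv.refl n)).sum_comp]
    congr 1
    refine Finset.sum_congr rfl fun k _ => ?_
    congr 1
    · rw [← e.symm.prod_comp]
      simp
    · congr 1
      ext f
      simp
  · congr 2
    ext f
    simp

/-! ### Networks with legs, their operators and their composition. -/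

/-- A finite multigraph whose edges carry matrices, with input and output legs attached to
some of its vertices. -/
structure Network (V E I O n : Type) where
  /-- source of an edge -/
  src : E → V
  /-- target of an edge -/
  tgt : E → V
  /-- matrix of an edge -/
  mat : E → Matrix n n ℂ
  /-- vertex of an input -/
  inp : I → V
  /-- vertex of an output -/
  out : O → V

namespace Network

variable {V E I O n : Type}

/-- The edge has exactly one end in `X`. -/
def Crosses (K : Network V E I O n) (X : Set V) (e : E) : Prop :=
  ¬ (K.src e ∈ X ↔ K.tgt e ∈ X)

/-- Every nonempty set of vertices is linked to the inputs and to the outputs, and is linked to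
the rest in two ways. -/
structure Linked (K : Network V E I O n) : Prop where
  inp_or : ∀ X : Set V, X.Nonempty → (∃ i, K.inp i ∈ X) ∨ ∃ e, K.Crosses X e
  out_or : ∀ X : Set V, X.Nonempty → (∃ o, K.out o ∈ X) ∨ ∃ e, K.Crosses X e
  two : ∀ X : Set V, ∀ e, K.Crosses X e →
    (∃ i, K.inp i ∈ X) ∨ (∃ o, K.out o ∈ X) ∨ ∃ e', e' ≠ e ∧ K.Crosses X e'

/-- The weight of a labelling of the vertices. -/
def weight [Fintype E] (K : Network V E I O n) (φ : V → n) : ℂ :=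
  ∏ e, K.mat e (φ (K.src e)) (φ (K.tgt e))

/-- Reverse some of the edges. -/
def flip (K : Network V E I O n) (s : E → Bool) : Network V E I O n where
  src e := if s e then K.tgt e else K.src e
  tgt e := if s e then K.src e else K.tgt e
  mat e := if s e then (K.mat e)ᵀ else K.mat e
  inp := K.inp
  out := K.out

theorem crosses_flip (K : Network V E I O n) (s : E → Bool) (X : Set V) (e : E) :
    (K.flip s).Crosses X e ↔ K.Crosses X e := by
  unfold Crosses flip
  by_cases h : s e <;> (simp [h]; try tauto)

theorem weight_flip [Fintype E] (K : Network V E I O n) (s : E → Bool) (φ : V → n) :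
    (K.flip s).weight φ = K.weight φ := by
  unfold weight flip
  refine Finset.prod_congr rfl fun e _ => ?_
  by_cases h : s e <;> simp [h]

theorem Linked.flip {K : Network V E I O n} (h : K.Linked) (s : E → Bool) :
    (K.flip s).Linked where
  inp_or X hX := by simp only [crosses_flip]; exact h.inp_or X hX
  out_or X hX := by simp only [crosses_flip]; exact h.out_or X hX
  two X e he := by
    simp only [crosses_flip]
    exact h.two X e ((crosses_flip K s X e).1 he)

theorem bicontraction_flip [Fintype n] {K : Network V E I O n} (h : ∀ e, IsBicontraction (K.mat e))
    (s : E → Bool) (e : E) : IsBicontraction ((K.flip s).mat e) := by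
  by_cases hs : s e <;> simp [Network.flip, hs, h, (h e).transpose]

variable [Fintype V] [DecidableEq V] [Fintype E] [Fintype I] [DecidableEq I] [Fintype O]
  [DecidableEq O] [Fintype n] [DecidableEq n]

/-- The operator from the functions on the labellings of the inputs to the functions on the
labellings of the outputs. -/
def op (K : Network V E I O n) (x : (I → n) → ℂ) (c : O → n) : ℂ :=
  ∑ φ : V → n, if φ ∘ K.out = c then K.weight φ * x (φ ∘ K.inp) else 0

/-- The operator of the network is a contraction for the `ℓ²` norms. -/
def IsContraction (K : Network V E I O n) : Prop :=
  ∀ x : (I → n) → ℂ, ∑ c, ‖K.op x c‖ ^ 2 ≤ ∑ a, ‖x a‖ ^ 2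

theorem isContraction_flip (K : Network V E I O n) (s : E → Bool) :
    (K.flip s).IsContraction ↔ K.IsContraction := by
  unfold IsContraction op
  simp only [weight_flip]
  rfl

theorem isContraction_of_equiv {V' E' I' O' : Type} [Fintype V'] [DecidableEq V'] [Fintype E']
    [Fintype I'] [DecidableEq I'] [Fintype O'] [DecidableEq O']
    (K : Network V E I O n) (K' : Network V' E' I' O' n) (eV : V ≃ V') (eE : E ≃ E')
    (eI : I ≃ I') (eO : O ≃ O') (hs : ∀ e, K'.src (eE e) = eV (K.src e))
    (ht : ∀ e, K'.tgt (eE e) = eV (K.tgt e)) (hm : ∀ e, K'.mat (eE e) = K.mat e)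
    (hi : ∀ i, K'.inp (eI i) = eV (K.inp i)) (ho : ∀ o, K'.out (eO o) = eV (K.out o))
    (h : K.IsContraction) : K'.IsContraction := by
  intro x
  have h1 := h (fun a => x (a ∘ eI.symm))
  rw [← (Equiv.arrowCongr eO (Equiv.refl n)).sum_comp,
    ← (Equiv.arrowCongr eI (Equiv.refl n)).sum_comp]
  refine le_trans (le_of_eq ?_) h1
  refine Finset.sum_congr rfl fun c _ => ?_
  congr 2
  unfold op
  rw [← (Equiv.arrowCongr eV (Equiv.refl n)).sum_comp]
  refine Finset.sum_congr rfl fun φ _ => ?_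
  have h2 : (Equiv.arrowCongr eV (Equiv.refl n)) φ ∘ K'.out = (Equiv.arrowCongr eO (Equiv.refl n)) c
      ↔ φ ∘ K.out = c := by
    constructor
    · intro h; ext o
      have := congrFun h (eO o)
      simpa [ho] using this
    · intro h; ext o
      obtain ⟨o, rfl⟩ := eO.surjective o
      have := congrFun h o
      simpa [ho] using this
  have h3 : K'.weight ((Equiv.arrowCongr eV (Equiv.refl n)) φ) = K.weight φ := by
    unfold weight
    rw [← eE.prod_comp]
    simp [hs, ht, hm]
  have h4 : (Equiv.arrowCongr eV (Equiv.refl n)) φ ∘ K'.inp = (φ ∘ K.inp) ∘ eI.symm := by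
    ext i
    obtain ⟨i, rfl⟩ := eI.surjective i
    simp [hi]
  simp only [h2, h3, h4]

section append

variable {V₁ V₂ E₁ E₂ I₁ I₂ O₁ O₂ F : Type} [Fintype V₁] [DecidableEq V₁] [Fintype V₂]
  [DecidableEq V₂] [Fintype E₁] [Fintype E₂] [Fintype I₁] [DecidableEq I₁] [Fintype I₂]
  [DecidableEq I₂] [Fintype O₁] [DecidableEq O₁] [Fintype O₂] [DecidableEq O₂] [Fintype F]
  [DecidableEq F]

/-- Connect some outputs of a network to some inputs of another one, by edges that carry given
matrices. -/
def append (K₁ : Network V₁ E₁ I₁ (O₁ ⊕ F) n) (B : F → Matrix n n ℂ)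
    (K₂ : Network V₂ E₂ (I₂ ⊕ F) O₂ n) :
    Network (V₁ ⊕ V₂) (E₁ ⊕ E₂ ⊕ F) (I₁ ⊕ I₂) (O₁ ⊕ O₂) n where
  src := Sum.elim (fun e => .inl (K₁.src e))
    (Sum.elim (fun e => .inr (K₂.src e)) fun f => .inl (K₁.out (.inr f)))
  tgt := Sum.elim (fun e => .inl (K₁.tgt e))
    (Sum.elim (fun e => .inr (K₂.tgt e)) fun f => .inr (K₂.inp (.inr f)))
  mat := Sum.elim K₁.mat (Sum.elim K₂.mat B)
  inp := Sum.elim (fun i => .inl (K₁.inp i)) fun i => .inr (K₂.inp (.inl i))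
  out := Sum.elim (fun o => .inl (K₁.out (.inl o))) fun o => .inr (K₂.out o)

/-- The operator of the composite is `K₁`, then the tensor product of the `B f`, then `K₂`. The
labels of the inputs of `K₂` outside `F` and of the outputs of `K₁` outside `F` are spectators. -/
theorem op_append (K₁ : Network V₁ E₁ I₁ (O₁ ⊕ F) n) (B : F → Matrix n n ℂ)
    (K₂ : Network V₂ E₂ (I₂ ⊕ F) O₂ n) (x : (I₁ ⊕ I₂ → n) → ℂ) (c₁ : O₁ → n) (c₂ : O₂ → n) :
    (append K₁ B K₂).op x (Sum.elim c₁ c₂) =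
      K₂.op (fun b => ∑ k : F → n, (∏ f, B f (k f) (b (.inr f))) *
        K₁.op (fun a => x (Sum.elim a (b ∘ Sum.inl))) (Sum.elim c₁ k)) c₂ := by
  unfold op
  rw [← (Equiv.sumArrowEquivProdArrow V₁ V₂ n).symm.sum_comp, Fintype.sum_prod_type,
    Finset.sum_comm]
  refine Finset.sum_congr rfl fun β _ => ?_
  by_cases hβ : β ∘ K₂.out = c₂
  · rw [if_pos hβ]
    simp only [Finset.mul_sum]
    rw [Finset.sum_comm]
    refine Finset.sum_congr rfl fun α _ => ?_
    -- A labelling `α` of the first piece determines the labels `k` of its outputs in `F`, so the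
    -- sum over `k` has a single nonzero term.
    rw [Finset.sum_eq_single (fun f => α (K₁.out (.inr f)))]
    · have h1 : ((Equiv.sumArrowEquivProdArrow V₁ V₂ n).symm (α, β) ∘ (append K₁ B K₂).out =
          Sum.elim c₁ c₂) ↔ (α ∘ K₁.out = Sum.elim c₁ fun f => α (K₁.out (.inr f))) := by
        constructor
        · intro h; ext o
          rcases o with o | o
          · simpa [append, Equiv.sumArrowEquivProdArrow] using congrFun h (.inl o)
          · rfl
        · intro h; ext o
          rcases o with o | o
          · simpa [append, Equiv.sumArrowEquivProdArrow] using congrFun h (.inl o)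
          · simpa [append, Equiv.sumArrowEquivProdArrow] using congrFun hβ o
      by_cases h : α ∘ K₁.out = Sum.elim c₁ fun f => α (K₁.out (.inr f))
      · rw [if_pos (h1.2 h), if_pos h]
        have h2 : (Equiv.sumArrowEquivProdArrow V₁ V₂ n).symm (α, β) ∘ (append K₁ B K₂).inp =
            Sum.elim (α ∘ K₁.inp) ((β ∘ K₂.inp) ∘ Sum.inl) := by
          ext i
          rcases i with i | i <;> simp [append, Equiv.sumArrowEquivProdArrow]
        rw [h2]
        simp [weight, append, Equiv.sumArrowEquivProdArrow]
        ring
      · rw [if_neg (fun h' => h (h1.1 h')), if_neg h]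
        simp
    · intro k _ hk
      rw [if_neg, mul_zero, mul_zero]
      intro h
      apply hk
      ext f
      simpa using (congrFun h (.inr f)).symm
    · simp
  · rw [if_neg hβ]
    refine Finset.sum_eq_zero fun α _ => ?_
    rw [if_neg]
    intro h
    apply hβ
    ext o
    simpa [append, Equiv.sumArrowEquivProdArrow] using congrFun h (.inr o)

theorem sum_sumArrow {I₁ I₂ : Type} [Fintype I₁] [DecidableEq I₁] [Fintype I₂] [DecidableEq I₂]
    (g : (I₁ ⊕ I₂ → n) → ℝ) :
    ∑ a, g a = ∑ a : I₁ → n, ∑ b : I₂ → n, g (Sum.elim a b) := by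
  rw [← (Equiv.sumArrowEquivProdArrow I₁ I₂ n).symm.sum_comp, Fintype.sum_prod_type]
  rfl

/-- By `op_append` three contractions are composed, each applied with the spectator labels fixed and
then summed over. -/
theorem isContraction_append {K₁ : Network V₁ E₁ I₁ (O₁ ⊕ F) n} {B : F → Matrix n n ℂ}
    {K₂ : Network V₂ E₂ (I₂ ⊕ F) O₂ n} (h₁ : K₁.IsContraction)
    (hB : ∀ f, IsBicontraction (B f)) (h₂ : K₂.IsContraction) :
    (append K₁ B K₂).IsContraction := by
  intro x
  rw [sum_sumArrow, sum_sumArrow]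
  simp only [op_append]
  calc _ ≤ ∑ c₁ : O₁ → n, ∑ b : I₂ → n, ∑ k' : F → n, ‖∑ k : F → n, (∏ f, B f (k f) (k' f)) *
        K₁.op (fun a => x (Sum.elim a b)) (Sum.elim c₁ k)‖ ^ 2 := by
        refine Finset.sum_le_sum fun c₁ _ => (h₂ _).trans ?_
        rw [sum_sumArrow]
        rfl
    _ ≤ ∑ c₁ : O₁ → n, ∑ b : I₂ → n, ∑ k : F → n,
        ‖K₁.op (fun a => x (Sum.elim a b)) (Sum.elim c₁ k)‖ ^ 2 :=
        Finset.sum_le_sum fun c₁ _ => Finset.sum_le_sum fun b _ => tensor_contraction B hB _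
    _ = ∑ b : I₂ → n, ∑ c, ‖K₁.op (fun a => x (Sum.elim a b)) c‖ ^ 2 := by
        rw [Finset.sum_comm]
        simp only [sum_sumArrow]
    _ ≤ ∑ b : I₂ → n, ∑ a, ‖x (Sum.elim a b)‖ ^ 2 :=
        Finset.sum_le_sum fun b _ => h₁ _
    _ = _ := Finset.sum_comm

end append

end Network

/-! ### Legs at a single vertex, and splitting a network in two. -/

namespace Network

variable {V E I O n : Type} [Fintype V] [DecidableEq V] [Fintype E] [Fintype I] [DecidableEq I]
  [Fintype O] [DecidableEq O] [Fintype n] [DecidableEq n]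

/-- All legs read the same label, so the operator is diagonal on constant leg labellings and
vanishes elsewhere; `hd` bounds its diagonal entries. -/
theorem sum_op_sq_of_single (K : Network V E I O n) (v : V) [Nonempty I] [Nonempty O]
    (hi : ∀ i, K.inp i = v) (ho : ∀ o, K.out o = v)
    (hd : ∀ a : n, ‖∑ φ : V → n, if φ v = a then K.weight φ else 0‖ ≤ 1) : K.IsContraction := by
  intro x
  have hinp : ∀ φ : V → n, φ ∘ K.inp = Function.const I (φ v) := fun φ => by ext i; simp [hi]
  have hout : ∀ φ : V → n, φ ∘ K.out = Function.const O (φ v) := fun φ => by ext i; simp [ho]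
  have h1 : ∀ a : n, K.op x (Function.const O a) =
      (∑ φ : V → n, if φ v = a then K.weight φ else 0) * x (Function.const I a) := by
    intro a
    unfold op
    rw [Finset.sum_mul]
    refine Finset.sum_congr rfl fun φ _ => ?_
    rw [hinp, hout]
    by_cases h : φ v = a
    · simp [h]
    · rw [if_neg h, if_neg, zero_mul]
      exact fun h' => h (Function.const_injective h')
  have h2 : ∑ a : n, ‖K.op x (Function.const O a)‖ ^ 2 = ∑ c, ‖K.op x c‖ ^ 2 := by
    refine Fintype.sum_of_injective (Function.const O) Function.const_injective _ _ ?_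
      fun _ => rfl
    intro c hc
    have : K.op x c = 0 := by
      refine Finset.sum_eq_zero fun φ _ => if_neg ?_
      rw [hout]
      exact fun h => hc ⟨_, h⟩
    simp [this]
  rw [← h2]
  calc _ ≤ ∑ a : n, ‖x (Function.const I a)‖ ^ 2 := by
        refine Finset.sum_le_sum fun a _ => ?_
        rw [h1, norm_mul]
        gcongr
        exact mul_le_of_le_one_left (norm_nonneg _) (hd a)
    _ = ∑ b ∈ Finset.univ.map ⟨Function.const I, Function.const_injective⟩, ‖x b‖ ^ 2 := by
        rw [Finset.sum_map]; rfl
    _ ≤ _ := Finset.sum_le_sum_of_subset_of_nonneg (Finset.subset_univ _)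
        fun _ _ _ => by positivity

/-- Remove an edge, and put the unique input and the unique output at its ends. -/
def cutEdge (K : Network V E I O n) (e₀ : E) : Network V {e // e ≠ e₀} Unit Unit n where
  src e := K.src e
  tgt e := K.tgt e
  mat e := K.mat e
  inp _ := K.src e₀
  out _ := K.tgt e₀

/-- The diagonal entry at `a` pairs the image of the basis vector at `a` under the cut network with
row `a` of the matrix of `e₀`. Both have `ℓ²` norm at most one, so Cauchy–Schwarz concludes. -/
theorem norm_sum_le_one_of_cutEdge [DecidableEq E] (K : Network V E I O n) (e₀ : E)
    (h : IsBicontraction (K.mat e₀)) (hc : (K.cutEdge e₀).IsContraction) (a : n) :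
    ‖∑ φ : V → n, if φ (K.src e₀) = a then K.weight φ else 0‖ ≤ 1 := by
  have h1 : (∑ φ : V → n, if φ (K.src e₀) = a then K.weight φ else 0) =
      ∑ c : n, (K.cutEdge e₀).op (fun b => if b () = a then 1 else 0) (fun _ => c) *
        K.mat e₀ a c := by
    simp only [op, Finset.sum_mul]
    rw [Finset.sum_comm]
    refine Finset.sum_congr rfl fun φ _ => ?_
    rw [Finset.sum_eq_single (φ (K.tgt e₀))]
    · have h2 : φ ∘ (K.cutEdge e₀).out = fun _ => φ (K.tgt e₀) := rfl
      rw [if_pos h2]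
      have h3 : K.weight φ = (K.cutEdge e₀).weight φ * K.mat e₀ (φ (K.src e₀)) (φ (K.tgt e₀)) := by
        unfold weight cutEdge
        rw [Fintype.prod_eq_mul_prod_subtype_ne _ e₀, mul_comm]
      by_cases h4 : φ (K.src e₀) = a
      · simp [cutEdge, h4, h3]
      · simp [cutEdge, h4]
    · intro c _ hc
      rw [if_neg, zero_mul]
      intro h
      exact hc (congrFun h ()).symm
    · simp
  have h2 : ∑ c : n, ‖(K.cutEdge e₀).op (fun b => if b () = a then 1 else 0) (fun _ => c)‖ ^ 2
      ≤ 1 := by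
    have := hc (fun b => if b () = a then 1 else 0)
    rw [← (Equiv.funUnique Unit n).symm.sum_comp, ← (Equiv.funUnique Unit n).symm.sum_comp] at this
    refine le_trans (le_of_eq rfl) (this.trans (le_of_eq ?_))
    simp [apply_ite, ite_pow]
  rw [h1]
  have h3 := (Finset.sum_mul_sq_le_sq_mul_sq Finset.univ
    (fun c => ‖(K.cutEdge e₀).op (fun b => if b () = a then 1 else 0) (fun _ => c)‖)
    (fun c => ‖K.mat e₀ a c‖)).trans
      (mul_le_one₀ h2 (Finset.sum_nonneg fun _ _ => by positivity) (h.sum_row_le a))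
  refine (norm_sum_le _ _).trans ?_
  simp only [norm_mul]
  exact (sq_le_one_iff₀ (Finset.sum_nonneg fun _ _ => by positivity)).1 h3

/-- With all legs at one vertex there is no bridge: one side of it would carry no leg. Hence a
bridge created by deleting `e₀` separates the ends of `e₀`, where the new legs sit. -/
theorem Linked.cutEdge {K : Network V E I O n} (h : K.Linked) (e₀ : E)
    (hi : ∀ i, K.inp i = K.src e₀) (ho : ∀ o, K.out o = K.src e₀) :
    (K.cutEdge e₀).Linked := by
  have key : ∀ X : Set V, K.src e₀ ∉ X → ∀ e, K.Crosses X e → ∃ e', e' ≠ e ∧ K.Crosses X e' := by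
    intro X hX e he
    rcases h.two X e he with ⟨i, h⟩ | ⟨o, h⟩ | h
    · exact absurd (hi i ▸ h) hX
    · exact absurd (ho o ▸ h) hX
    · exact h
  have hcompl : ∀ X : Set V, ∀ e, K.Crosses Xᶜ e ↔ K.Crosses X e := by
    intro X e
    unfold Crosses
    simp only [Set.mem_compl_iff]
    tauto
  have key' : ∀ X : Set V, ∀ e, K.Crosses X e → ∃ e', e' ≠ e ∧ K.Crosses X e' := by
    intro X e he
    by_cases hX : K.src e₀ ∈ X
    · simp only [← hcompl X] at he ⊢
      exact key Xᶜ (by simpa using hX) e he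
    · exact key X hX e he
  have cross : ∀ X : Set V, (∃ e, K.Crosses X e) → ∃ e, (K.cutEdge e₀).Crosses X e := by
    rintro X ⟨e, he⟩
    by_cases h0 : e = e₀
    · obtain ⟨e', h1, h2⟩ := key' X e he
      exact ⟨⟨e', h0 ▸ h1⟩, h2⟩
    · exact ⟨⟨e, h0⟩, he⟩
  have tgt_or : ∀ X : Set V, X.Nonempty → (K.tgt e₀ ∈ X) ∨ ∃ e, K.Crosses X e := by
    intro X hX
    rcases h.inp_or X hX with ⟨i, hi'⟩ | h'
    · by_cases ht : K.tgt e₀ ∈ X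
      · exact .inl ht
      · rw [hi i] at hi'
        exact .inr ⟨e₀, by simp [Crosses, hi', ht]⟩
    · exact .inr h'
  constructor
  · intro X hX
    rcases h.inp_or X hX with ⟨i, hi'⟩ | h'
    · exact .inl ⟨(), by simpa [Network.cutEdge, hi] using hi'⟩
    · exact .inr (cross X h')
  · intro X hX
    rcases tgt_or X hX with h' | h'
    · exact .inl ⟨(), h'⟩
    · exact .inr (cross X h')
  · intro X e he
    by_cases h1 : K.Crosses X e₀
    · by_cases h2 : K.src e₀ ∈ X
      · exact .inl ⟨(), h2⟩
      · refine .inr (.inl ⟨(), ?_⟩)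
        unfold Crosses at h1
        simp only [Network.cutEdge]
        tauto
    · obtain ⟨e', h3, h4⟩ := key' X e he
      refine .inr (.inr ⟨⟨e', ?_⟩, ?_, h4⟩)
      · rintro rfl; exact h1 h4
      · intro h5; apply h3; rw [← h5]

section restrict

/-- The part of the network on `U`, the edges that leave `U` becoming outputs. -/
def left (K : Network V E I O n) (U : Set V) :
    Network {v // v ∈ U} {e // K.src e ∈ U ∧ K.tgt e ∈ U} {i // K.inp i ∈ U}
      ({o // K.out o ∈ U} ⊕ {e // K.src e ∈ U ∧ K.tgt e ∉ U}) n where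
  src e := ⟨K.src e, e.2.1⟩
  tgt e := ⟨K.tgt e, e.2.2⟩
  mat e := K.mat e
  inp i := ⟨K.inp i, i.2⟩
  out := Sum.elim (fun o => ⟨K.out o, o.2⟩) fun e => ⟨K.src e, e.2.1⟩

/-- The part of the network outside of `U`, the edges that leave `U` becoming inputs. -/
def right (K : Network V E I O n) (U : Set V) (hU : ∀ e, K.tgt e ∈ U → K.src e ∈ U) :
    Network {v // v ∉ U} {e // K.src e ∉ U}
      ({i // K.inp i ∉ U} ⊕ {e // K.src e ∈ U ∧ K.tgt e ∉ U}) {o // K.out o ∉ U} n where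
  src e := ⟨K.src e, e.2⟩
  tgt e := ⟨K.tgt e, fun h => e.2 (hU _ h)⟩
  mat e := K.mat e
  inp := Sum.elim (fun i => ⟨K.inp i, i.2⟩) fun e => ⟨K.tgt e, e.2.2⟩
  out o := ⟨K.out o, o.2⟩

theorem isContraction_of_left_right [DecidableEq E] (K : Network V E I O n) (U : Set V)
    [DecidablePred (· ∈ U)] (hU : ∀ e, K.tgt e ∈ U → K.src e ∈ U)
    (hK : ∀ e, IsBicontraction (K.mat e))
    (h₁ : (K.left U).IsContraction) (h₂ : (K.right U hU).IsContraction) : K.IsContraction := by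
  have h := isContraction_append h₁
    (B := fun f : {e // K.src e ∈ U ∧ K.tgt e ∉ U} => K.mat f) (fun f => hK f) h₂
  let g : {e // K.src e ∈ U ∧ K.tgt e ∈ U} ⊕ {e // K.src e ∉ U} ⊕
      {e // K.src e ∈ U ∧ K.tgt e ∉ U} → E := Sum.elim (↑) (Sum.elim (↑) (↑))
  have hg : Function.Bijective g := by
    constructor
    · rintro (⟨e, he⟩ | ⟨e, he⟩ | ⟨e, he⟩) (⟨e', he'⟩ | ⟨e', he'⟩ | ⟨e', he'⟩) h <;>
        (change e = e' at h; subst h; first | rfl | (exfalso; tauto))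
    · intro e
      by_cases h1 : K.src e ∈ U
      · by_cases h2 : K.tgt e ∈ U
        · exact ⟨.inl ⟨e, h1, h2⟩, rfl⟩
        · exact ⟨.inr (.inr ⟨e, h1, h2⟩), rfl⟩
      · exact ⟨.inr (.inl ⟨e, h1⟩), rfl⟩
  refine isContraction_of_equiv _ K (Equiv.sumCompl (· ∈ U)) (Equiv.ofBijective g hg)
    (Equiv.sumCompl (K.inp · ∈ U)) (Equiv.sumCompl (K.out · ∈ U)) ?_ ?_ ?_ ?_ ?_ h
  · rintro (e | e | e) <;> rfl
  · rintro (e | e | e) <;> rfl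
  · rintro (e | e | e) <;> rfl
  · rintro (e | e) <;> rfl
  · rintro (e | e) <;> rfl

/-- Edges leaving `U` turn into outputs, which preserves the link to the outputs and the condition
on bridges. Only the link to the inputs can be lost, hence `hUi`. -/
theorem Linked.left {K : Network V E I O n} (h : K.Linked) (U : Set V)
    (hU : ∀ e, K.tgt e ∈ U → K.src e ∈ U)
    (hUi : ∀ X ⊆ U, X.Nonempty → (∃ i, K.inp i ∈ X) ∨
      ∃ e, K.Crosses X e ∧ K.src e ∈ U ∧ K.tgt e ∈ U) : (K.left U).Linked := by
  have mem : ∀ (X : Set {v // v ∈ U}) (v : V) (hv : v ∈ U),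
      v ∈ Subtype.val '' X ↔ (⟨v, hv⟩ : {v // v ∈ U}) ∈ X := by
    intro X v hv
    simp [hv]
  have cr : ∀ (X : Set {v // v ∈ U}) (e) (he : K.src e ∈ U ∧ K.tgt e ∈ U),
      (K.left U).Crosses X ⟨e, he⟩ ↔ K.Crosses (Subtype.val '' X) e := by
    intro X e he
    unfold Crosses
    rw [mem X _ he.1, mem X _ he.2]
    rfl
  have cases : ∀ (X : Set {v // v ∈ U}) (e), K.Crosses (Subtype.val '' X) e →
      (∃ he, (K.left U).Crosses X ⟨e, he⟩) ∨ ∃ he, (K.left U).out (.inr ⟨e, he⟩) ∈ X := by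
    intro X e he
    by_cases h1 : K.src e ∈ U
    · by_cases h2 : K.tgt e ∈ U
      · exact .inl ⟨⟨h1, h2⟩, (cr X e ⟨h1, h2⟩).2 he⟩
      · refine .inr ⟨⟨h1, h2⟩, ?_⟩
        have h3 : K.tgt e ∉ Subtype.val '' X := by
          rintro ⟨v, -, hv⟩; exact h2 (hv ▸ v.2)
        have h4 : K.src e ∈ Subtype.val '' X := by unfold Crosses at he; tauto
        exact (mem X _ h1).1 h4
    · have h2 : K.tgt e ∉ U := fun h2 => h1 (hU e h2)
      exfalso
      apply he
      constructor
      · rintro ⟨v, -, hv⟩; exact absurd (hv ▸ v.2) h1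
      · rintro ⟨v, -, hv⟩; exact absurd (hv ▸ v.2) h2
  have inpc : ∀ (X : Set {v // v ∈ U}), (∃ i, K.inp i ∈ Subtype.val '' X) →
      ∃ i, (K.left U).inp i ∈ X := by
    rintro X ⟨i, v, hv, hvi⟩
    have : K.inp i ∈ U := hvi ▸ v.2
    exact ⟨⟨i, this⟩, (mem X _ this).1 ⟨v, hv, hvi⟩⟩
  have outc : ∀ (X : Set {v // v ∈ U}), (∃ i, K.out i ∈ Subtype.val '' X) →
      ∃ o, (K.left U).out (.inl o) ∈ X := by
    rintro X ⟨i, v, hv, hvi⟩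
    have : K.out i ∈ U := hvi ▸ v.2
    exact ⟨⟨i, this⟩, (mem X _ this).1 ⟨v, hv, hvi⟩⟩
  constructor
  · intro X hX
    rcases hUi (Subtype.val '' X) (by rintro _ ⟨v, -, rfl⟩; exact v.2) (hX.image _) with
      h' | ⟨e, h1, h2⟩
    · exact .inl (inpc X h')
    · exact .inr ⟨⟨e, h2⟩, (cr X e h2).2 h1⟩
  · intro X hX
    rcases h.out_or _ (hX.image Subtype.val) with h' | ⟨e, he⟩
    · obtain ⟨o, ho⟩ := outc X h'
      exact .inl ⟨_, ho⟩
    · rcases cases X e he with ⟨h1, h2⟩ | ⟨h1, h2⟩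
      · exact .inr ⟨_, h2⟩
      · exact .inl ⟨_, h2⟩
  · rintro X ⟨e, he⟩ hc
    rcases h.two _ e ((cr X e he).1 hc) with h' | h' | ⟨e', hne, he'⟩
    · exact .inl (inpc X h')
    · obtain ⟨o, ho⟩ := outc X h'
      exact .inr (.inl ⟨_, ho⟩)
    · rcases cases X e' he' with ⟨h1, h2⟩ | ⟨h1, h2⟩
      · exact .inr (.inr ⟨⟨e', h1⟩, fun h => hne (congrArg Subtype.val h), h2⟩)
      · exact .inr (.inl ⟨_, h2⟩)

/-- Dual to `Linked.left`: edges coming from `U` turn into inputs, so only the link to the outputs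
has to be supplied. -/
theorem Linked.right {K : Network V E I O n} (h : K.Linked) (U : Set V)
    (hU : ∀ e, K.tgt e ∈ U → K.src e ∈ U)
    (hUo : ∀ X ⊆ Uᶜ, X.Nonempty → (∃ o, K.out o ∈ X) ∨
      ∃ e, K.Crosses X e ∧ K.src e ∉ U) : (K.right U hU).Linked := by
  have mem : ∀ (X : Set {v // v ∉ U}) (v : V) (hv : v ∉ U),
      v ∈ Subtype.val '' X ↔ (⟨v, hv⟩ : {v // v ∉ U}) ∈ X := by
    intro X v hv
    simp [hv]
  have cr : ∀ (X : Set {v // v ∉ U}) (e) (he : K.src e ∉ U),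
      (K.right U hU).Crosses X ⟨e, he⟩ ↔ K.Crosses (Subtype.val '' X) e := by
    intro X e he
    unfold Crosses
    rw [mem X _ he, mem X _ (fun h => he (hU _ h))]
    rfl
  have cases : ∀ (X : Set {v // v ∉ U}) (e), K.Crosses (Subtype.val '' X) e →
      (∃ he, (K.right U hU).Crosses X ⟨e, he⟩) ∨
        ∃ he, (K.right U hU).inp (.inr ⟨e, he⟩) ∈ X := by
    intro X e he
    by_cases h1 : K.src e ∈ U
    · have h3 : K.src e ∉ Subtype.val '' X := by
        rintro ⟨v, -, hv⟩; exact v.2 (hv ▸ h1)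
      have h4 : K.tgt e ∈ Subtype.val '' X := by unfold Crosses at he; tauto
      have h2 : K.tgt e ∉ U := by
        obtain ⟨v, -, hv⟩ := h4; exact hv ▸ v.2
      exact .inr ⟨⟨h1, h2⟩, (mem X _ h2).1 h4⟩
    · exact .inl ⟨h1, (cr X e h1).2 he⟩
  have inpc : ∀ (X : Set {v // v ∉ U}), (∃ i, K.inp i ∈ Subtype.val '' X) →
      ∃ i, (K.right U hU).inp (.inl i) ∈ X := by
    rintro X ⟨i, v, hv, hvi⟩
    have : K.inp i ∉ U := hvi ▸ v.2
    exact ⟨⟨i, this⟩, (mem X _ this).1 ⟨v, hv, hvi⟩⟩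
  have outc : ∀ (X : Set {v // v ∉ U}), (∃ i, K.out i ∈ Subtype.val '' X) →
      ∃ o, (K.right U hU).out o ∈ X := by
    rintro X ⟨i, v, hv, hvi⟩
    have : K.out i ∉ U := hvi ▸ v.2
    exact ⟨⟨i, this⟩, (mem X _ this).1 ⟨v, hv, hvi⟩⟩
  constructor
  · intro X hX
    rcases h.inp_or _ (hX.image Subtype.val) with h' | ⟨e, he⟩
    · obtain ⟨o, ho⟩ := inpc X h'
      exact .inl ⟨_, ho⟩
    · rcases cases X e he with ⟨h1, h2⟩ | ⟨h1, h2⟩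
      · exact .inr ⟨_, h2⟩
      · exact .inl ⟨_, h2⟩
  · intro X hX
    rcases hUo (Subtype.val '' X) (by rintro _ ⟨v, -, rfl⟩; exact v.2) (hX.image _) with
      h' | ⟨e, h1, h2⟩
    · exact .inl (outc X h')
    · exact .inr ⟨⟨e, h2⟩, (cr X e h2).2 h1⟩
  · rintro X ⟨e, he⟩ hc
    rcases h.two _ e ((cr X e he).1 hc) with h' | h' | ⟨e', hne, he'⟩
    · obtain ⟨o, ho⟩ := inpc X h'
      exact .inl ⟨_, ho⟩
    · exact .inr (.inl (outc X h'))
    · rcases cases X e' he' with ⟨h1, h2⟩ | ⟨h1, h2⟩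
      · exact .inr (.inr ⟨⟨e', h1⟩, fun h => hne (congrArg Subtype.val h), h2⟩)
      · exact .inl ⟨_, h2⟩

end restrict

/-- The vertices that are joined to an output by edges that avoid `v`. -/
def reach (K : Network V E I O n) (v : V) : Set V :=
  ⋂₀ {S | v ∉ S ∧ (∀ o, K.out o ≠ v → K.out o ∈ S) ∧
    ∀ e, K.src e ≠ v → K.tgt e ≠ v → (K.src e ∈ S ↔ K.tgt e ∈ S)}

theorem notMem_reach (K : Network V E I O n) (v : V) : v ∉ K.reach v := by
  intro h
  have := h {w | w ≠ v} ⟨by simp, fun o h => h, fun e h1 h2 => by simp [h1, h2]⟩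
  simp at this

theorem out_mem_reach (K : Network V E I O n) {v : V} {o : O} (h : K.out o ≠ v) :
    K.out o ∈ K.reach v :=
  fun _ hS => hS.2.1 o h

theorem src_mem_reach_iff (K : Network V E I O n) {v : V} {e : E} (h1 : K.src e ≠ v)
    (h2 : K.tgt e ≠ v) : K.src e ∈ K.reach v ↔ K.tgt e ∈ K.reach v :=
  ⟨fun h S hS => (hS.2.2 e h1 h2).1 (h S hS), fun h S hS => (hS.2.2 e h1 h2).2 (h S hS)⟩

/-- Otherwise `K.reach v \ X` would still satisfy the closure conditions, against the minimality of
`K.reach v`. -/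
theorem out_or_of_subset_reach (K : Network V E I O n) (v : V) {X : Set V} (hX : X ⊆ K.reach v)
    (hne : X.Nonempty) : (∃ o, K.out o ∈ X) ∨
      ∃ e, K.Crosses X e ∧ K.src e ∈ K.reach v ∧ K.tgt e ∈ K.reach v := by
  by_contra! hcon
  obtain ⟨h1, h2⟩ := hcon
  obtain ⟨x, hx⟩ := hne
  have := hX hx (K.reach v \ X) ⟨fun h => K.notMem_reach v h.1,
    fun o ho => ⟨K.out_mem_reach ho, h1 o⟩, ?_⟩
  · exact this.2 hx
  · intro e hs ht
    have h3 := K.src_mem_reach_iff hs ht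
    have h4 := h2 e
    unfold Crosses at h4
    simp only [Set.mem_sdiff]
    tauto

/-- A set that avoids both `v` and `K.reach v` has no output, so `Linked` provides a crossing edge.
That edge cannot enter `K.reach v`, which is joined to its complement only through edges at `v`. -/
theorem inp_or_of_subset_compl_reach {K : Network V E I O n} (hK : K.Linked) {v : V} {i₀ : I}
    (hv : K.inp i₀ = v) {X : Set V} (hX : X ⊆ (K.reach v)ᶜ) (hne : X.Nonempty) :
    (∃ i, K.inp i ∈ X) ∨
      ∃ e, K.Crosses X e ∧ K.src e ∉ K.reach v ∧ K.tgt e ∉ K.reach v := by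
  by_cases hvX : v ∈ X
  · exact .inl ⟨i₀, hv ▸ hvX⟩
  rcases hK.out_or X hne with ⟨o, ho⟩ | ⟨e, he⟩
  · refine absurd (K.out_mem_reach (v := v) ?_) (hX ho)
    rintro h
    exact hvX (h ▸ ho)
  · refine .inr ⟨e, he, ?_⟩
    have h0 := K.notMem_reach v
    have h1 : K.src e ∈ X → K.src e ∉ K.reach v := fun h => hX h
    have h2 : K.tgt e ∈ X → K.tgt e ∉ K.reach v := fun h => hX h
    by_cases h5 : K.src e = v
    · refine ⟨h5 ▸ h0, h2 ?_⟩
      unfold Crosses at he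
      rw [h5] at he
      tauto
    by_cases h6 : K.tgt e = v
    · refine ⟨h1 ?_, h6 ▸ h0⟩
      unfold Crosses at he
      rw [h6] at he
      tauto
    have h3 := K.src_mem_reach_iff h5 h6
    unfold Crosses at he
    tauto

theorem Linked.exists_inp {K : Network V E I O n} (hK : K.Linked) [Nonempty V] : Nonempty I := by
  rcases hK.inp_or Set.univ Set.univ_nonempty with ⟨i, -⟩ | ⟨e, he⟩
  · exact ⟨i⟩
  · simp [Crosses] at he

theorem Linked.exists_out {K : Network V E I O n} (hK : K.Linked) [Nonempty V] : Nonempty O := by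
  rcases hK.out_or Set.univ Set.univ_nonempty with ⟨i, -⟩ | ⟨e, he⟩
  · exact ⟨i⟩
  · simp [Crosses] at he

end Network

/-! ### The induction: linked networks are contractions. -/

theorem Network.Linked.isContraction_aux {n : Type} [Fintype n] [DecidableEq n] (m : ℕ) :
    ∀ (V E I O : Type) [Fintype V] [DecidableEq V] [Fintype E] [DecidableEq E] [Fintype I]
      [DecidableEq I] [Fintype O] [DecidableEq O] (K : Network V E I O n), K.Linked →
      (∀ e, IsBicontraction (K.mat e)) → Nonempty V → Fintype.card V + Fintype.card E ≤ m →
      K.IsContraction := by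
  classical
  induction m with
  | zero =>
    intro V E I O _ _ _ _ _ _ _ _ K _ _ hV hcard
    have := Fintype.card_pos (α := V)
    omega
  | succ m ih =>
    intro V E I O _ _ _ _ _ _ _ _ K hK hmat hV hcard
    have hI := hK.exists_inp
    have hO := hK.exists_out
    by_cases hreach : ∃ i, (K.reach (K.inp i)).Nonempty
    · obtain ⟨i, hW⟩ := hreach
      set v := K.inp i with hv
      set U : Set V := (K.reach v)ᶜ with hUdef
      have hUi : ∀ X ⊆ U, X.Nonempty → _ := fun X hX hne =>
        inp_or_of_subset_compl_reach hK hv.symm hX hne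
      have hUo : ∀ X ⊆ Uᶜ, X.Nonempty → _ := fun X hX hne =>
        K.out_or_of_subset_reach v (by simpa [hUdef] using hX) hne
      -- Reorient the edges between `U` and its complement so that they all leave `U`; the matrices
      -- are transposed accordingly.
      let s : E → Bool := fun e => decide (K.tgt e ∈ U ∧ K.src e ∉ U)
      rw [← K.isContraction_flip s]
      have hU : ∀ e, (K.flip s).tgt e ∈ U → (K.flip s).src e ∈ U := by
        intro e
        by_cases h : K.tgt e ∈ U ∧ K.src e ∉ U
        · simp [Network.flip, s, h]
        · have : s e = false := by simp only [s, decide_eq_false_iff_not]; exact h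
          simp only [Network.flip, this]
          simp only [Bool.false_eq_true, if_false]
          tauto
      have hmem : ∀ e, ((K.flip s).src e ∈ U ∧ (K.flip s).tgt e ∈ U) ↔
          (K.src e ∈ U ∧ K.tgt e ∈ U) := by
        intro e
        by_cases h : s e
        · simp [Network.flip, h, and_comm]
        · simp [Network.flip, h]
      have hmem' : ∀ e, ((K.flip s).src e ∉ U) ↔ (K.src e ∉ U ∧ K.tgt e ∉ U) := by
        intro e
        by_cases h : s e
        · have h' : K.tgt e ∈ U ∧ K.src e ∉ U := by simpa [s] using h
          simp [Network.flip, h, h']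
        · have h' : ¬ (K.tgt e ∈ U ∧ K.src e ∉ U) := by simpa [s] using h
          simp only [Network.flip, h, Bool.false_eq_true, if_false]
          tauto
      have hvU : v ∈ U := K.notMem_reach v
      obtain ⟨w, hw⟩ := hW
      have hwU : w ∉ U := by simpa [hUdef] using hw
      refine isContraction_of_left_right _ U hU (bicontraction_flip hmat s) ?_ ?_
      · refine ih _ _ _ _ _ ((hK.flip s).left U hU ?_) (fun e => bicontraction_flip hmat s e)
          ⟨⟨v, hvU⟩⟩ ?_
        · intro X hX hne
          simp only [crosses_flip, hmem]
          simp only [hUdef, Set.mem_compl_iff]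
          exact hUi X hX hne
        · have h1 := Fintype.card_subtype_lt (p := (· ∈ U)) hwU
          have h2 := Fintype.card_subtype_le (fun e => (K.flip s).src e ∈ U ∧ (K.flip s).tgt e ∈ U)
          omega
      · refine ih _ _ _ _ _ ((hK.flip s).right U hU ?_) (fun e => bicontraction_flip hmat s e)
          ⟨⟨w, hwU⟩⟩ ?_
        · intro X hX hne
          simp only [crosses_flip, hmem']
          simp only [hUdef, Set.mem_compl_iff, not_not]
          exact hUo X hX hne
        · have h1 := Fintype.card_subtype_lt (p := (· ∉ U)) (x := v) (by simpa using hvU)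
          have h2 := Fintype.card_subtype_le (fun e => (K.flip s).src e ∉ U)
          omega
    -- An output away from an input vertex would make `reach` nonempty there. So all legs are at one
    -- vertex.
    · have hout : ∀ i o, K.out o = K.inp i := by
        intro i o
        by_contra h
        exact hreach ⟨i, _, K.out_mem_reach h⟩
      obtain ⟨i₀⟩ := hI
      obtain ⟨o₀⟩ := hO
      set v := K.inp i₀ with hv
      have ho : ∀ o, K.out o = v := hout i₀
      have hi : ∀ i, K.inp i = v := fun i => by rw [← hout i o₀, ho]
      have : Nonempty I := ⟨i₀⟩
      have : Nonempty O := ⟨o₀⟩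
      by_cases hsub : ∀ w, w = v
      -- With a single vertex every edge is a loop, and the weight is a product of diagonal entries
      -- of contractions.
      · refine sum_op_sq_of_single K v hi ho fun a => ?_
        rw [Finset.sum_eq_single (fun _ => a)]
        · simp only [if_true, Network.weight, norm_prod]
          exact Finset.prod_le_one (fun _ _ => norm_nonneg _) fun e _ => (hmat e).norm_apply_le _ _
        · intro φ _ hφ
          rw [if_neg]
          intro h
          apply hφ
          ext w
          rw [hsub w, h]
        · simp
      · push Not at hsub
        obtain ⟨w, hw⟩ := hsub
        have : ∃ e, K.Crosses {v}ᶜ e := by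
          rcases hK.inp_or {v}ᶜ ⟨w, hw⟩ with ⟨i, h⟩ | h
          · exact absurd (hi i) h
          · exact h
        obtain ⟨e, he⟩ := this
        let s : E → Bool := fun e => decide (K.tgt e = v)
        rw [← K.isContraction_flip s]
        have hsrc : (K.flip s).src e = v := by
          by_cases h : K.tgt e = v
          · simp [Network.flip, s, h]
          · simp only [Network.flip, s, h]
            simp [Crosses, h] at he
            simpa using he
        refine sum_op_sq_of_single (K.flip s) v hi ho fun a => ?_
        rw [← hsrc]
        refine norm_sum_le_one_of_cutEdge (K.flip s) e (bicontraction_flip hmat s e) ?_ a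
        refine ih _ _ _ _ _ ((hK.flip s).cutEdge e (fun i => ?_) fun o => ?_)
          (fun e => bicontraction_flip hmat s e) hV ?_
        · rw [hsrc]; exact hi i
        · rw [hsrc]; exact ho o
        · have := Fintype.card_subtype_lt (p := (· ≠ e)) (x := e) (by simp)
          omega

/-- The operator of a linked network of contractions is a contraction. -/
theorem Network.Linked.isContraction {V E I O n : Type} [Fintype V] [DecidableEq V] [Nonempty V]
    [Fintype E] [DecidableEq E] [Fintype I] [DecidableEq I] [Fintype O] [DecidableEq O] [Fintype n]
    [DecidableEq n] {K : Network V E I O n} (hK : K.Linked)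
    (hmat : ∀ e, IsBicontraction (K.mat e)) : K.IsContraction :=
  isContraction_aux _ V E I O K hK hmat inferInstance le_rfl

/-- The sum of the weights of a linked network of contractions is at most the square root of the
number of labellings of its legs. -/
theorem Network.Linked.norm_sum_weight_sq_le {V E I O n : Type} [Fintype V] [DecidableEq V]
    [Nonempty V]
    [Fintype E] [DecidableEq E] [Fintype I] [DecidableEq I] [Fintype O] [DecidableEq O] [Fintype n]
    [DecidableEq n] {K : Network V E I O n} (hK : K.Linked)
    (hmat : ∀ e, IsBicontraction (K.mat e)) :
    ‖∑ φ, K.weight φ‖ ^ 2 ≤ (Fintype.card n : ℝ) ^ (Fintype.card I + Fintype.card O) := by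
  -- The total weight pairs the image of the constant `1` with the constant `1`; Cauchy–Schwarz
  -- costs one factor `card n` per output, and the norm of the input function one per input.
  have h1 : ∑ φ, K.weight φ = ∑ c, K.op (fun _ => 1) c := by
    unfold op
    rw [Finset.sum_comm]
    simp
  have h2 := hK.isContraction hmat (fun _ => 1)
  have h3 : ‖∑ c, K.op (fun _ => 1) c‖ ^ 2 ≤
      (Fintype.card (O → n) : ℝ) * ∑ c, ‖K.op (fun _ => 1) c‖ ^ 2 :=
    (pow_le_pow_left₀ (norm_nonneg _) (norm_sum_le _ _) 2).trans
      (sq_sum_le_card_mul_sum_sq (s := Finset.univ))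
  rw [h1]
  refine h3.trans ((mul_le_mul_of_nonneg_left h2 (by positivity)).trans (le_of_eq ?_))
  simp
  ring

/-! ### Cutting edges and leaves of a test graph. -/

namespace StarTestGraph

variable {p : ℕ} (T : StarTestGraph p)

/-- The edge has exactly one end in `X`. -/
def Crosses (X : Set (Fin T.nV)) (e : Fin T.nE) : Prop :=
  ¬ (T.src e ∈ X ↔ T.tgt e ∈ X)

/-- The edge is the only one with exactly one end in `X`. -/
def CrossesAlone (X : Set (Fin T.nV)) (e : Fin T.nE) : Prop :=
  T.Crosses X e ∧ ∀ e', T.Crosses X e' → e' = e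

theorem crosses_compl {X : Set (Fin T.nV)} {e : Fin T.nE} :
    T.Crosses Xᶜ e ↔ T.Crosses X e := by
  unfold Crosses
  simp only [Set.mem_compl_iff]
  tauto

theorem crossesAlone_compl {X : Set (Fin T.nV)} {e : Fin T.nE} :
    T.CrossesAlone Xᶜ e ↔ T.CrossesAlone X e := by
  simp [CrossesAlone, crosses_compl]

theorem spanBy_adj {F : Set (Fin T.nE)} {v w : Fin T.nV} : (T.spanBy F).Adj v w ↔
    v ≠ w ∧ ((∃ e ∈ F, T.src e = v ∧ T.tgt e = w) ∨ ∃ e ∈ F, T.src e = w ∧ T.tgt e = v) := by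
  simp [spanBy, SimpleGraph.fromRel_adj]

theorem mem_iff_of_reachable {F : Set (Fin T.nE)} {X : Set (Fin T.nV)}
    (h : ∀ e ∈ F, ¬ T.Crosses X e) {v w : Fin T.nV} (hr : (T.spanBy F).Reachable v w) :
    v ∈ X ↔ w ∈ X := by
  obtain ⟨q⟩ := hr
  induction q with
  | nil => rfl
  | cons ha _ ih =>
    rw [← ih]
    obtain ⟨-, ⟨e, he, rfl, rfl⟩ | ⟨e, he, rfl, rfl⟩⟩ := T.spanBy_adj.1 ha
    · exact not_not.1 (h e he)
    · exact (not_not.1 (h e he)).symm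

theorem reachable_of_mem {F : Set (Fin T.nE)} {e : Fin T.nE} (he : e ∈ F) :
    (T.spanBy F).Reachable (T.src e) (T.tgt e) := by
  by_cases h : T.src e = T.tgt e
  · rw [h]
  · exact (T.spanBy_adj.2 ⟨h, .inl ⟨e, he, rfl, rfl⟩⟩).reachable

theorem not_crosses_reachable {F : Set (Fin T.nE)} (v : Fin T.nV) {e : Fin T.nE} (he : e ∈ F) :
    ¬ T.Crosses {w | (T.spanBy F).Reachable v w} e := by
  unfold Crosses
  simp only [Set.mem_ofPred_eq, not_not]
  exact ⟨fun h => h.trans (T.reachable_of_mem he), fun h => h.trans (T.reachable_of_mem he).symm⟩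

theorem spanBy_univ_connected : (T.spanBy Set.univ).Connected := by
  have := T.connected
  convert this using 1
  ext v w
  simp [spanBy, SimpleGraph.fromRel_adj]

theorem exists_crosses {X : Set (Fin T.nV)} (h1 : X.Nonempty) (h2 : Xᶜ.Nonempty) :
    ∃ e, T.Crosses X e := by
  by_contra! h
  obtain ⟨v, hv⟩ := h1
  obtain ⟨w, hw⟩ := h2
  exact hw ((T.mem_iff_of_reachable (fun e _ => h e)
    (T.spanBy_univ_connected.preconnected v w)).1 hv)

theorem CrossesAlone.isCutting {T : StarTestGraph p} {X : Set (Fin T.nV)} {e : Fin T.nE}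
    (h : T.CrossesAlone X e) : T.IsCutting e := by
  intro hc
  exact h.1 (T.mem_iff_of_reachable (F := {e}ᶜ) (fun e' he' hc => he' (h.2 e' hc))
    (hc.preconnected _ _))

theorem IsCutting.exists_crossesAlone {T : StarTestGraph p} {e : Fin T.nE} (h : T.IsCutting e) :
    ∃ X, T.CrossesAlone X e := by
  have hne : Nonempty (Fin T.nV) := T.connected.nonempty
  have : ¬ (T.spanBy {e}ᶜ).Preconnected := fun h' => h ⟨h'⟩
  unfold SimpleGraph.Preconnected at this
  push Not at this
  obtain ⟨v, w, hvw⟩ := this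
  refine ⟨{x | (T.spanBy {e}ᶜ).Reachable v x}, ?_⟩
  have h1 : ∀ e', T.Crosses {x | (T.spanBy {e}ᶜ).Reachable v x} e' → e' = e := by
    intro e' he'
    by_contra hne
    exact T.not_crosses_reachable v (F := {e}ᶜ) hne he'
  obtain ⟨e', he'⟩ := T.exists_crosses (X := {x | (T.spanBy {e}ᶜ).Reachable v x})
    ⟨v, SimpleGraph.Reachable.refl v⟩ ⟨w, hvw⟩
  exact ⟨h1 e' he' ▸ he', h1⟩

theorem comp_eq_iff {v w : Fin T.nV} : T.comp v = T.comp w ↔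
    (T.spanBy {e | ¬ T.IsCutting e}).Reachable v w :=
  SimpleGraph.ConnectedComponent.eq

theorem comp_surjective : Function.Surjective T.comp := by
  intro C
  induction C using SimpleGraph.ConnectedComponent.ind with | h v => exact ⟨v, rfl⟩

theorem CrossesAlone.mem_iff_of_comp_eq {T : StarTestGraph p} {X : Set (Fin T.nV)} {e : Fin T.nE}
    (h : T.CrossesAlone X e) {v w : Fin T.nV} (hvw : T.comp v = T.comp w) : v ∈ X ↔ w ∈ X :=
  T.mem_iff_of_reachable (F := {e | ¬ T.IsCutting e})
    (fun _ he' hc => he' (h.2 _ hc ▸ h.isCutting)) (T.comp_eq_iff.1 hvw)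

theorem comp_src_eq_comp_tgt {e : Fin T.nE} (h : ¬ T.IsCutting e) :
    T.comp (T.src e) = T.comp (T.tgt e) :=
  T.comp_eq_iff.2 (T.reachable_of_mem h)

theorem comp_src_ne_comp_tgt {e : Fin T.nE} (h : T.IsCutting e) :
    T.comp (T.src e) ≠ T.comp (T.tgt e) := by
  obtain ⟨X, hX⟩ := h.exists_crossesAlone
  exact fun h => hX.1 (hX.mem_iff_of_comp_eq h)

/-- The leaves of the tree of two-edge connected components. -/
def leafSet : Set T.TwoEdgeComp := {C | (T.compTree.neighborSet C).ncard = 1}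

/-- A set that is minimal among those that are crossed by a single edge is a leaf. -/
theorem leaf_of_minimal {X : Set (Fin T.nV)} {f : Fin T.nE} (hf : T.CrossesAlone X f)
    (hmin : ∀ Y ⊂ X, ∀ e, ¬ T.CrossesAlone Y e) :
    ∃ C ∈ T.leafSet, ∀ v, T.comp v = C → v ∈ X := by
  obtain ⟨u, u', hu, hu', huu⟩ : ∃ u u', u ∈ X ∧ u' ∉ X ∧
      ((T.src f = u ∧ T.tgt f = u') ∨ (T.src f = u' ∧ T.tgt f = u)) := by
    by_cases h : T.src f ∈ X
    · exact ⟨_, _, h, fun h' => hf.1 (by tauto), .inl ⟨rfl, rfl⟩⟩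
    · refine ⟨T.tgt f, T.src f, ?_, h, .inr ⟨rfl, rfl⟩⟩
      by_contra h'
      exact hf.1 (by tauto)
  have hf_not : ∀ Z : Set (Fin T.nV), u ∉ Z → u' ∉ Z → ¬ T.Crosses Z f := by
    intro Z h1 h2
    rcases huu with ⟨h3, h4⟩ | ⟨h3, h4⟩ <;> simp [Crosses, h3, h4, h1, h2]
  -- If `e` inside `X` were cutting, take the side `Z` that misses `u`. Then `f` does not cross `Z ∩
  -- X`, so `e` alone crosses it, against minimality.
  have inner : ∀ e, T.src e ∈ X → T.tgt e ∈ X → ¬ T.IsCutting e := by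
    intro e hs ht he
    obtain ⟨Z, hZ, huZ⟩ : ∃ Z, T.CrossesAlone Z e ∧ u ∉ Z := by
      obtain ⟨Z, hZ⟩ := he.exists_crossesAlone
      by_cases h : u ∈ Z
      · exact ⟨Zᶜ, T.crossesAlone_compl.2 hZ, by simpa using h⟩
      · exact ⟨Z, hZ, h⟩
    refine hmin (Z ∩ X) ⟨Set.inter_subset_right, fun h => huZ (h hu).1⟩ e ⟨?_, ?_⟩
    · have := hZ.1
      unfold Crosses at this ⊢
      simp only [Set.mem_inter_iff, hs, ht, and_true]
      exact this
    · intro e' he'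
      by_cases h1 : T.Crosses Z e'
      · exact hZ.2 e' h1
      by_cases h2 : T.Crosses X e'
      · exfalso
        rw [hf.2 e' h2] at he'
        exact hf_not _ (fun h => huZ h.1) (fun h => hu' h.2) he'
      · exfalso
        unfold Crosses at h1 h2 he'
        simp only [Set.mem_inter_iff] at he'
        tauto
  have hsub : ∀ v, T.comp v = T.comp u → v ∈ X := fun v hv => (hf.mem_iff_of_comp_eq hv).2 hu
  -- Together with `hsub`, `X` is exactly one component: an edge inside `X` that left the component
  -- of `u` would be cutting.
  have hsup : ∀ v ∈ X, T.comp v = T.comp u := by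
    by_contra! hcon
    obtain ⟨w, hw, hwu⟩ := hcon
    obtain ⟨e, he⟩ := T.exists_crosses (X := {v | v ∈ X ∧ T.comp v ≠ T.comp u})
      ⟨w, hw, hwu⟩ ⟨u, fun h => h.2 rfl⟩
    have h1 : ¬ T.Crosses X e := fun h => hf_not _ (fun h => h.2 rfl) (fun h => hu' h.1)
      (hf.2 e h ▸ he)
    have h2 : T.src e ∈ X ∧ T.tgt e ∈ X := by
      unfold Crosses at he h1
      simp only [Set.mem_ofPred_eq] at he
      tauto
    have h3 := T.comp_src_eq_comp_tgt (inner e h2.1 h2.2)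
    apply he
    simp [h2.1, h2.2, h3]
  refine ⟨T.comp u, ?_, hsub⟩
  -- The only cutting edge at this component is `f`, so it has one neighbor.
  have hnb : T.compTree.neighborSet (T.comp u) = {T.comp u'} := by
    have hcut : ∀ e v w, T.IsCutting e → ((T.src e = v ∧ T.tgt e = w) ∨
        (T.src e = w ∧ T.tgt e = v)) → T.comp v = T.comp u → T.comp w = T.comp u' := by
      intro e v w he hvw hv
      have hvX := hsub v hv
      have hwX : w ∉ X := by
        intro hw
        rcases hvw with ⟨rfl, rfl⟩ | ⟨rfl, rfl⟩
        · exact inner e hvX hw he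
        · exact inner e hw hvX he
      have : e = f := hf.2 e (by
        rcases hvw with ⟨rfl, rfl⟩ | ⟨rfl, rfl⟩ <;> simp [Crosses, hvX, hwX])
      subst this
      rcases hvw with ⟨h1, h2⟩ | ⟨h1, h2⟩ <;> rcases huu with ⟨h3, h4⟩ | ⟨h3, h4⟩
      · rw [← h2, h4]
      · exact absurd (h3 ▸ h1 ▸ hvX) hu'
      · exact absurd (h4 ▸ h2 ▸ hvX) hu'
      · rw [← h1, h3]
    ext C
    simp only [SimpleGraph.mem_neighborSet, compTree, SimpleGraph.fromRel_adj,
      Set.mem_singleton_iff]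
    constructor
    · rintro ⟨-, ⟨e, he, h1, h2⟩ | ⟨e, he, h1, h2⟩⟩
      · rw [← h2]; exact hcut e _ _ he (.inl ⟨rfl, rfl⟩) h1
      · rw [← h1]; exact hcut e _ _ he (.inr ⟨rfl, rfl⟩) h2
    · rintro rfl
      refine ⟨fun h => hu' ((hf.mem_iff_of_comp_eq h).1 hu), ?_⟩
      rcases huu with ⟨rfl, rfl⟩ | ⟨rfl, rfl⟩
      · exact .inl ⟨f, hf.isCutting, rfl, rfl⟩
      · exact .inr ⟨f, hf.isCutting, rfl, rfl⟩
  simp [leafSet, hnb]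

/-- Shrink `X` to a minimal set crossed by a single edge. -/
theorem exists_leaf_subset {X : Set (Fin T.nV)} {f : Fin T.nE} (hf : T.CrossesAlone X f) :
    ∃ C ∈ T.leafSet, ∀ v, T.comp v = C → v ∈ X := by
  induction hn : X.ncard using Nat.strong_induction_on generalizing X f with
  | _ n ih =>
    by_cases h : ∃ Y ⊂ X, ∃ e, T.CrossesAlone Y e
    · obtain ⟨Y, hY, e, he⟩ := h
      obtain ⟨C, hC, h⟩ := ih _ (hn ▸ Set.ncard_lt_ncard hY) he rfl
      exact ⟨C, hC, fun v hv => hY.1 (h v hv)⟩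
    · push Not at h
      exact T.leaf_of_minimal hf h

theorem CrossesAlone.not_subsingleton {T : StarTestGraph p} {X : Set (Fin T.nV)} {e : Fin T.nE}
    (h : T.CrossesAlone X e) : ¬ Subsingleton T.TwoEdgeComp :=
  fun _ => T.comp_src_ne_comp_tgt h.isCutting (Subsingleton.elim _ _)

theorem subsingleton_of_forall_not_isCutting (h : ∀ e, ¬ T.IsCutting e) :
    Subsingleton T.TwoEdgeComp := by
  have h1 : {e | ¬ T.IsCutting e} = Set.univ := by ext e; simp [h]
  constructor
  intro C C'
  obtain ⟨v, rfl⟩ := T.comp_surjective C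
  obtain ⟨w, rfl⟩ := T.comp_surjective C'
  rw [comp_eq_iff, h1]
  exact T.spanBy_univ_connected.preconnected v w

theorem leaves_of_subsingleton (h : Subsingleton T.TwoEdgeComp) : T.leaves = 2 := by
  rw [leaves, if_pos h]

theorem leaves_of_not_subsingleton (h : ¬ Subsingleton T.TwoEdgeComp) :
    T.leaves = T.leafSet.ncard := by
  rw [leaves, if_neg h]; rfl

/-- Each side of a cutting edge contains a leaf. -/
theorem two_le_leaves : 2 ≤ T.leaves := by
  by_cases h : Subsingleton T.TwoEdgeComp
  · rw [T.leaves_of_subsingleton h]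
  · rw [T.leaves_of_not_subsingleton h]
    obtain ⟨e, he⟩ : ∃ e, T.IsCutting e := by
      by_contra! h'
      exact h (T.subsingleton_of_forall_not_isCutting h')
    obtain ⟨X, hX⟩ := he.exists_crossesAlone
    obtain ⟨C, hC, h1⟩ := T.exists_leaf_subset hX
    obtain ⟨C', hC', h2⟩ := T.exists_leaf_subset (T.crossesAlone_compl.2 hX)
    have hne : C ≠ C' := by
      rintro rfl
      obtain ⟨v, hv⟩ := T.comp_surjective C
      exact h2 v hv (h1 v hv)
    exact (Set.one_lt_ncard (Set.toFinite _)).2 ⟨C, hC, C', hC', hne⟩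

/-- Along a closed walk the edges entering `X` balance those leaving it, whereas a single crossing
edge would contribute `±1`. -/
theorem IsCyclic.not_isCutting {T : StarTestGraph p} (h : T.IsCyclic) (e : Fin T.nE) :
    ¬ T.IsCutting e := by
  classical
  intro he
  obtain ⟨X, hX⟩ := he.exists_crossesAlone
  obtain ⟨σ, hσ⟩ := h
  have h1 : ∑ e, (if T.tgt e ∈ X then (1 : ℤ) else 0) = ∑ e, if T.src e ∈ X then (1 : ℤ) else 0 := by
    rw [← Equiv.sum_comp σ (fun e => if T.tgt e ∈ X then (1 : ℤ) else 0),
      ← Equiv.sum_comp ((finRotate T.nE).trans σ) (fun e => if T.src e ∈ X then (1 : ℤ) else 0)]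
    exact Finset.sum_congr rfl fun k _ => by rw [hσ]; rfl
  have h2 : ∑ e, ((if T.tgt e ∈ X then (1 : ℤ) else 0) - if T.src e ∈ X then (1 : ℤ) else 0) = 0 := by
    rw [Finset.sum_sub_distrib, h1, sub_self]
  rw [Finset.sum_eq_single e] at h2
  · apply hX.1
    by_cases h3 : T.tgt e ∈ X <;> by_cases h4 : T.src e ∈ X <;> simp [h3, h4] at h2 ⊢
  · intro e' _ hne
    have h5 : ¬ T.Crosses X e' := fun h => hne (hX.2 e' h)
    simp only [Crosses, not_not] at h5
    simp [h5]
  · simp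

theorem IsCyclic.leaves_eq_two {T : StarTestGraph p} (h : T.IsCyclic) : T.leaves = 2 :=
  T.leaves_of_subsingleton (T.subsingleton_of_forall_not_isCutting h.not_isCutting)

/-! ### The Mingo–Speicher bound. -/

/-- The network of a test graph, with legs at the given vertices. -/
def network {n I O : Type} (A : Fin T.nE → Matrix n n ℂ) (inp : I → Fin T.nV)
    (out : O → Fin T.nV) : Network (Fin T.nV) (Fin T.nE) I O n where
  src := T.src
  tgt := T.tgt
  mat := A
  inp := inp
  out := out

/-- Connectedness takes care of the links to inputs and outputs, so only sets crossed by a single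
edge need a leg. -/
theorem linked_network {n I O : Type} [hI : Nonempty I] [hO : Nonempty O]
    (A : Fin T.nE → Matrix n n ℂ)
    (inp : I → Fin T.nV) (out : O → Fin T.nV)
    (h : ∀ X e, T.CrossesAlone X e → (∃ i, inp i ∈ X) ∨ ∃ o, out o ∈ X) :
    (T.network A inp out).Linked := by
  have key : ∀ (J : Type) (_ : Nonempty J) (g : J → Fin T.nV) (X : Set (Fin T.nV)), X.Nonempty →
      (∃ j, g j ∈ X) ∨ ∃ e, T.Crosses X e := by
    rintro J ⟨j⟩ g X hX
    by_cases hj : g j ∈ X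
    · exact .inl ⟨j, hj⟩
    · exact .inr (T.exists_crosses hX ⟨_, hj⟩)
  refine ⟨key I hI inp, key O hO out, fun X e he => ?_⟩
  by_cases h' : ∃ e', e' ≠ e ∧ T.Crosses X e'
  · exact .inr (.inr h')
  · have : T.CrossesAlone X e := ⟨he, fun e' he' => by
      by_contra hne
      exact h' ⟨e', hne, he'⟩⟩
    rcases h X e this with h | h
    · exact .inl h
    · exact .inr (.inl h)

/-- The sharp bound of Mingo and Speicher on the sums of the entries of contractions along a
graph. -/
theorem norm_sum_prod_sq_le {N : ℕ} (A : Fin T.nE → Matrix (Fin N) (Fin N) ℂ)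
    (hA : ∀ e, IsBicontraction (A e)) :
    ‖∑ φ : Fin T.nV → Fin N, ∏ e, A e (φ (T.src e)) (φ (T.tgt e))‖ ^ 2 ≤ (N : ℝ) ^ T.leaves := by
  classical
  have hne : Nonempty (Fin T.nV) := T.connected.nonempty
  by_cases h : Subsingleton T.TwoEdgeComp
  -- Without bridges one input and one output at the same vertex suffice: two legs, in agreement
  -- with the convention of two leaves.
  · let v := hne.some
    have hl : (T.network A (fun _ : Unit => v) (fun _ : Unit => v)).Linked :=
      T.linked_network _ _ _ fun X e he => absurd h he.not_subsingleton
    have := hl.norm_sum_weight_sq_le hA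
    rw [T.leaves_of_subsingleton h]
    exact le_of_le_of_eq this (by simp)
  · have h2 := T.two_le_leaves
    have hcard := T.leaves_of_not_subsingleton h
    have h3 : 1 < T.leafSet.ncard := by omega
    obtain ⟨C₀, hC₀, C₁, hC₁, h01⟩ := (Set.one_lt_ncard (Set.toFinite _)).1 h3
    choose g hg using T.comp_surjective
    -- The leaf `C₀` carries the output and all other leaves carry inputs, which makes `T.leaves`
    -- legs in total.
    let J := {C : T.TwoEdgeComp // C ∈ T.leafSet ∧ C ≠ C₀}
    have : Nonempty J := ⟨⟨C₁, hC₁, h01.symm⟩⟩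
    have : Fintype J := Fintype.ofFinite J
    have hl : (T.network A (fun j : J => g j.1) (fun _ : Unit => g C₀)).Linked := by
      refine T.linked_network _ _ _ fun X e he => ?_
      obtain ⟨C, hC, hCX⟩ := T.exists_leaf_subset he
      by_cases h0 : C = C₀
      · exact .inr ⟨(), hCX _ (h0 ▸ hg C₀)⟩
      · exact .inl ⟨⟨C, hC, h0⟩, hCX _ (hg C)⟩
    have h4 := hl.norm_sum_weight_sq_le hA
    have h5 : Fintype.card J + Fintype.card Unit = T.leaves := by
      rw [hcard, ← Set.ncard_sdiff_singleton_add_one hC₀ (Set.toFinite _), ← Nat.card_eq_fintype_card]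
      rfl
    rw [h5] at h4
    exact le_of_le_of_eq h4 (by simp)

end StarTestGraph

/-! ### Matrices bounded in operator norm. -/

theorem sum_norm_sq_mulVec_le {N : ℕ} {M : Matrix (Fin N) (Fin N) ℂ}
    (h : ‖Matrix.toEuclideanCLM (𝕜 := ℂ) M‖ ≤ 1) (f : Fin N → ℂ) :
    ∑ i, ‖∑ j, M i j * f j‖ ^ 2 ≤ ∑ j, ‖f j‖ ^ 2 := by
  have h1 := (Matrix.toEuclideanCLM (𝕜 := ℂ) M).le_of_opNorm_le h (WithLp.toLp 2 f)
  rw [one_mul] at h1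
  have h2 := pow_le_pow_left₀ (norm_nonneg _) h1 2
  rw [EuclideanSpace.norm_sq_eq, EuclideanSpace.norm_sq_eq] at h2
  simpa [Matrix.toEuclideanCLM_toLp, Matrix.mulVec, dotProduct] using h2

theorem norm_toEuclideanCLM_conjTranspose {N : ℕ} (M : Matrix (Fin N) (Fin N) ℂ) :
    ‖Matrix.toEuclideanCLM (𝕜 := ℂ) Mᴴ‖ = ‖Matrix.toEuclideanCLM (𝕜 := ℂ) M‖ := by
  rw [← Matrix.star_eq_conjTranspose, map_star, ContinuousLinearMap.star_eq_adjoint]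
  exact LinearIsometryEquiv.norm_map _ _

/-- The transpose is the entrywise conjugate of the adjoint, and conjugation preserves `ℓ²` norms.
-/
theorem isBicontraction_of_norm_le {N : ℕ} {M : Matrix (Fin N) (Fin N) ℂ}
    (h : ‖Matrix.toEuclideanCLM (𝕜 := ℂ) M‖ ≤ 1) : IsBicontraction M := by
  refine ⟨fun f => ?_, sum_norm_sq_mulVec_le h⟩
  have h1 := sum_norm_sq_mulVec_le ((norm_toEuclideanCLM_conjTranspose M).trans_le h)
    (fun i => starRingEnd ℂ (f i))
  simp only [RCLike.norm_conj] at h1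
  refine le_of_eq_of_le (Finset.sum_congr rfl fun j _ => ?_) h1
  rw [← RCLike.norm_conj (∑ i, M i j * f i)]
  simp

theorem norm_entry_le {N : ℕ} {M : Matrix (Fin N) (Fin N) ℂ} {C : ℝ}
    (h : ‖Matrix.toEuclideanCLM (𝕜 := ℂ) M‖ ≤ C) (k l : Fin N) : ‖M k l‖ ≤ C := by
  have h1 := (Matrix.toEuclideanCLM (𝕜 := ℂ) M).le_of_opNorm_le h
    (WithLp.toLp 2 (Pi.single l 1))
  have h2 := (PiLp.norm_apply_le (Matrix.toEuclideanCLM (𝕜 := ℂ) M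
    (WithLp.toLp 2 (Pi.single l 1))) k).trans h1
  simpa [Matrix.toEuclideanCLM_toLp] using h2

theorem norm_starVal_le {p N : ℕ} {A : Fin p → Matrix (Fin N) (Fin N) ℂ} {C : ℝ}
    (h : ∀ j, ‖Matrix.toEuclideanCLM (𝕜 := ℂ) (A j)‖ ≤ C) (x : Fin p × Bool) :
    ‖Matrix.toEuclideanCLM (𝕜 := ℂ) (starVal A x)‖ ≤ C := by
  unfold starVal
  split_ifs
  · rw [norm_toEuclideanCLM_conjTranspose]; exact h _
  · exact h _

namespace StarTestGraph

variable {p : ℕ} (T : StarTestGraph p)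

/-- Dividing each matrix by `C` gives contractions; the exponent `-1` comes from the normalization
of the trace. -/
theorem norm_trace_le {N : ℕ} (hN : 0 < N) {A : Fin p → Matrix (Fin N) (Fin N) ℂ} {C : ℝ}
    (hC : 0 < C) (h : ∀ j, ‖Matrix.toEuclideanCLM (𝕜 := ℂ) (A j)‖ ≤ C) :
    ‖T.trace A‖ ≤ C ^ T.nE * (N : ℝ) ^ ((T.leaves : ℝ) / 2 - 1) := by
  have hN' : (0 : ℝ) < N := by exact_mod_cast hN
  let B : Fin T.nE → Matrix (Fin N) (Fin N) ℂ := fun e => ((C : ℂ)⁻¹) • starVal A (T.label e)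
  have hB : ∀ e, IsBicontraction (B e) := by
    intro e
    apply isBicontraction_of_norm_le
    rw [map_smul, norm_smul, norm_inv, Complex.norm_real, Real.norm_of_nonneg hC.le,
      inv_mul_le_iff₀ hC, mul_one]
    exact norm_starVal_le h _
  have h1 := T.norm_sum_prod_sq_le B hB
  have h2 : ∑ φ : Fin T.nV → Fin N, ∏ e, starVal A (T.label e) (φ (T.src e)) (φ (T.tgt e)) =
      (C : ℂ) ^ T.nE * ∑ φ : Fin T.nV → Fin N, ∏ e, B e (φ (T.src e)) (φ (T.tgt e)) := by
    rw [Finset.mul_sum]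
    refine Finset.sum_congr rfl fun φ _ => ?_
    have hC' : (C : ℂ) ≠ 0 := by exact_mod_cast hC.ne'
    simp only [B, Matrix.smul_apply, smul_eq_mul, Finset.prod_mul_distrib, Finset.prod_const,
      Finset.card_univ, Fintype.card_fin, ← mul_assoc, ← mul_pow, mul_inv_cancel₀ hC', one_pow,
      one_mul]
  have h3 : ‖∑ φ : Fin T.nV → Fin N, ∏ e, B e (φ (T.src e)) (φ (T.tgt e))‖ ≤
      (N : ℝ) ^ ((T.leaves : ℝ) / 2) := by
    refine le_of_sq_le_sq ?_ (by positivity)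
    refine h1.trans (le_of_eq ?_)
    rw [← Real.rpow_natCast, ← Real.rpow_natCast, ← Real.rpow_mul hN'.le]
    congr 1
    push_cast
    ring
  unfold trace
  rw [h2, norm_mul, norm_mul, norm_inv, norm_pow, Complex.norm_real, Real.norm_of_nonneg hC.le,
    Complex.norm_natCast, Real.rpow_sub_one hN'.ne']
  calc _ ≤ (N : ℝ)⁻¹ * (C ^ T.nE * (N : ℝ) ^ ((T.leaves : ℝ) / 2)) := by gcongr
    _ = _ := by ring

/-- Makes the product of discs indexed by test graphs first countable, so that compactness yields
subsequences. -/
instance : Countable (StarTestGraph p) := by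
  let g : StarTestGraph p → Σ n : ℕ × ℕ, (Fin n.2 → Fin n.1) × (Fin n.2 → Fin n.1) ×
      (Fin n.2 → Fin p × Bool) := fun T => ⟨(T.nV, T.nE), T.src, T.tgt, T.label⟩
  have hg : Function.Injective g := by
    rintro ⟨a, b, s, t, l, h⟩ ⟨a', b', s', t', l', h'⟩ he
    simp only [g, Sigma.mk.injEq, Prod.mk.injEq] at he
    obtain ⟨⟨rfl, rfl⟩, he⟩ := he
    simp only [heq_eq_eq, Prod.mk.injEq] at he
    obtain ⟨rfl, rfl, rfl⟩ := he
    rfl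
  exact hg.countable

end StarTestGraph

variable {p : ℕ} {Ω : ℕ → Type*} [∀ N, MeasurableSpace (Ω N)]

/-- All exponents `leaves / 2 - 1` are nonnegative by `two_le_leaves`. -/
theorem isBigO_one_growth (n : ℕ) (T : Fin n → StarTestGraph p) {u : ℕ → ℂ}
    (hu : u =O[atTop] fun _ => (1 : ℝ)) :
    u =O[atTop] fun N : ℕ => (N : ℝ) ^ (∑ i, (((T i).leaves : ℝ) / 2 - 1)) := by
  refine hu.trans (IsBigO.of_bound 1 ?_)
  filter_upwards [eventually_gt_atTop 0] with N hN
  have h : 0 ≤ ∑ i, (((T i).leaves : ℝ) / 2 - 1) := Finset.sum_nonneg fun i _ => by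
    have h : (2 : ℝ) ≤ (T i).leaves := by exact_mod_cast (T i).two_le_leaves
    linarith
  have h1 := Real.one_le_rpow (x := (N : ℝ)) (by exact_mod_cast hN) h
  rw [norm_one, one_mul]
  exact h1.trans (Real.le_norm_self _)

variable (P : ∀ N, Measure (Ω N)) [∀ N, IsProbabilityMeasure (P N)]

theorem finiteMoments_of_bounded {Y : RandomFamily p Ω} {N : ℕ}
    (hm : ∀ j k l, Measurable fun ω => Y N j ω k l) {C : ℝ}
    (h : ∀ j, ∀ᵐ ω ∂(P N), ∀ k l, ‖Y N j ω k l‖ ≤ C) : FiniteMoments P Y N := by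
  intro j k l m
  exact MemLp.of_bound (hm j k l).aestronglyMeasurable C ((h j).mono fun ω hω => hω k l)

theorem bounded_operator_norm (Y : RandomFamily p Ω)
    (hm : ∀ N j k l, Measurable (fun ω => Y N j ω k l))
    (hC : ∃ C : ℝ, ∀ N j, ∀ᵐ ω ∂(P N), ‖Matrix.toEuclideanCLM (𝕜 := ℂ) (Y N j ω)‖ ≤ C) :
    (∃ φ : ℕ → ℕ, StrictMono φ ∧ ConvTrafficsAlong P Y φ) ∧ GrowthControl P Y := by
  obtain ⟨C₀, hC₀⟩ := hC
  obtain ⟨C, hCpos, hC⟩ : ∃ C : ℝ, 0 < C ∧ ∀ N, ∀ᵐ ω ∂(P N), ∀ j,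
      ‖Matrix.toEuclideanCLM (𝕜 := ℂ) (Y N j ω)‖ ≤ C := by
    refine ⟨max C₀ 1, by positivity, fun N => ?_⟩
    rw [ae_all_iff]
    exact fun j => (hC₀ N j).mono fun ω h => h.trans (le_max_left _ _)
  have hfm : ∀ N, FiniteMoments P Y N := fun N =>
    finiteMoments_of_bounded P (hm N) fun j => (hC N).mono fun ω h k l => norm_entry_le (h j) k l
  have htr : ∀ (T : StarTestGraph p) (N : ℕ), 0 < N → ∀ᵐ ω ∂(P N),
      ‖randTrace Y T N ω‖ ≤ C ^ T.nE * (N : ℝ) ^ ((T.leaves : ℝ) / 2 - 1) :=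
    fun T N hN => (hC N).mono fun ω h => T.norm_trace_le hN hCpos h
  refine ⟨?_, hfm, ?_⟩
  · let I := {T : StarTestGraph p // T.IsCyclic}
    -- The shift to `N + 1` avoids size `0`, where the trace bound is not available. For cyclic
    -- graphs the power of `N` has exponent `0`, so `u` stays in a fixed product of discs.
    let u : ℕ → I → ℂ := fun N T => ∫ ω, randTrace Y T.1 (N + 1) ω ∂(P (N + 1))
    have hu : ∀ N, u N ∈ Set.univ.pi fun T : I => Metric.closedBall (0 : ℂ) (C ^ T.1.nE) := by
      intro N T _
      rw [mem_closedBall_zero_iff]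
      have h := norm_integral_le_of_norm_le_const (htr T.1 (N + 1) N.succ_pos)
      simpa [T.2.leaves_eq_two] using h
    obtain ⟨a, -, φ, hφ, hlim⟩ := (isCompact_univ_pi fun T : I =>
      isCompact_closedBall (0 : ℂ) (C ^ T.1.nE)).tendsto_subseq hu
    refine ⟨fun n => φ n + 1, fun a b h => Nat.succ_lt_succ (hφ h), fun n => hfm _, fun T hT => ?_⟩
    exact ⟨a ⟨T, hT⟩, (tendsto_pi_nhds.1 hlim) ⟨T, hT⟩⟩
  · intro n T
    refine IsBigO.of_bound (∏ i, C ^ (T i).nE) ?_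
    filter_upwards [eventually_gt_atTop 0] with N hN
    have hN' : (0 : ℝ) < N := by exact_mod_cast hN
    have h1 : ∀ᵐ ω ∂(P N), ‖∏ i, randTrace Y (T i) N ω‖ ≤
        ∏ i, C ^ (T i).nE * (N : ℝ) ^ (((T i).leaves : ℝ) / 2 - 1) := by
      have := ae_all_iff.2 fun i => htr (T i) N hN
      filter_upwards [this] with ω hω
      rw [norm_prod]
      exact Finset.prod_le_prod (fun _ _ => norm_nonneg _) fun i _ => hω i
    have h2 := norm_integral_le_of_norm_le_const h1
    rw [probReal_univ, mul_one, Finset.prod_mul_distrib] at h2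
    refine h2.trans (le_of_eq ?_)
    rw [Real.norm_of_nonneg (by positivity), Real.rpow_sum_of_pos hN']


/-! ### Diagonal matrices. -/

theorem isDiag_starVal {p N : ℕ} {A : Fin p → Matrix (Fin N) (Fin N) ℂ} (h : ∀ j, (A j).IsDiag)
    (x : Fin p × Bool) : (starVal A x).IsDiag := by
  unfold starVal
  split_ifs
  · exact (h _).conjTranspose
  · exact h _

namespace StarTestGraph

variable {p : ℕ} (T : StarTestGraph p)

/-- The product of the labels of the edges. -/
noncomputable def monomial : StarPoly p :=
  (List.ofFn fun e => FreeAlgebra.ι ℂ (T.label e)).prod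

/-- By connectedness, a nonconstant labelling puts different labels on the ends of some edge, where
a diagonal matrix vanishes. The order of the factors in `monomial` is irrelevant, as diagonal
matrices commute. -/
theorem trace_eq_polyTrace_of_isDiag {N : ℕ} {A : Fin p → Matrix (Fin N) (Fin N) ℂ}
    (h : ∀ j, (A j).IsDiag) : T.trace A = polyTrace T.monomial A := by
  have hne : Nonempty (Fin T.nV) := T.connected.nonempty
  have h1 : FreeAlgebra.lift ℂ (starVal A) T.monomial =
      Matrix.diagonal fun k => ∏ e, starVal A (T.label e) k k := by
    unfold monomial
    rw [map_list_prod, List.map_ofFn]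
    have h2 : ((FreeAlgebra.lift ℂ (starVal A)) ∘ fun e => FreeAlgebra.ι ℂ (T.label e)) =
        (Matrix.diagonalRingHom (Fin N) ℂ) ∘ fun e k => starVal A (T.label e) k k := by
      ext1 e
      simp only [Function.comp, FreeAlgebra.lift_ι_apply]
      exact (isDiag_starVal h _).diagonal_diag.symm
    rw [h2, ← List.map_ofFn, ← map_list_prod, List.prod_ofFn]
    ext k l
    simp [Matrix.diagonal, Finset.prod_apply]
  unfold trace polyTrace
  rw [h1, Matrix.trace_diagonal]
  congr 1
  symm
  refine Fintype.sum_of_injective (Function.const (Fin T.nV)) Function.const_injective _ _ ?_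
    fun _ => rfl
  intro φ hφ
  obtain ⟨v⟩ := hne
  have h3 : {w | φ w = φ v}ᶜ.Nonempty := by
    by_contra hcon
    rw [Set.not_nonempty_iff_eq_empty, Set.compl_empty_iff, Set.eq_univ_iff_forall] at hcon
    exact hφ ⟨φ v, funext fun w => (hcon w).symm⟩
  obtain ⟨e, he⟩ := T.exists_crosses (X := {w | φ w = φ v}) ⟨v, rfl⟩ h3
  refine Finset.prod_eq_zero (Finset.mem_univ e) (isDiag_starVal h _ ?_)
  intro hcon
  apply he
  simp [hcon]

end StarTestGraph

variable {p : ℕ} {Ω : ℕ → Type*} [∀ N, MeasurableSpace (Ω N)]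
  (P : ∀ N, Measure (Ω N)) [∀ N, IsProbabilityMeasure (P N)]

theorem diagonal_matrices (D : RandomFamily p Ω)
    (hdiag : ∀ N j, ∀ᵐ ω ∂(P N), (D N j ω).IsDiag) (hlim : HasLimitStarDistribution P D)
    (hconc : ∀ (n : ℕ) (Q : Fin n → StarPoly p),
        Tendsto (fun N =>
          (∫ ω, ∏ i, polyTrace (Q i) (fun j => D N j ω) ∂(P N))
            - ∏ i, ∫ ω, polyTrace (Q i) (fun j => D N j ω) ∂(P N)) atTop (𝓝 0)) :
    ConvTraffics P D ∧ Concentration P D ∧ GrowthControl P D := by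
  have hae : ∀ N, ∀ᵐ ω ∂(P N), ∀ T : StarTestGraph p,
      randTrace D T N ω = polyTrace T.monomial fun j => D N j ω := by
    intro N
    filter_upwards [ae_all_iff.2 (hdiag N)] with ω hω T
    exact T.trace_eq_polyTrace_of_isDiag hω
  have h1 : ∀ (T : StarTestGraph p) N, ∫ ω, randTrace D T N ω ∂(P N) =
      ∫ ω, polyTrace T.monomial (fun j => D N j ω) ∂(P N) := fun T N =>
    integral_congr_ae ((hae N).mono fun ω h => h T)
  have h2 : ∀ (n : ℕ) (T : Fin n → StarTestGraph p) N, ∫ ω, ∏ i, randTrace D (T i) N ω ∂(P N) =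
      ∫ ω, ∏ i, polyTrace (T i).monomial (fun j => D N j ω) ∂(P N) := fun n T N =>
    integral_congr_ae ((hae N).mono fun ω h => Finset.prod_congr rfl fun i _ => h (T i))
  refine ⟨⟨fun n => hlim.1 n, fun T _ => ?_⟩, ⟨hlim.1, fun n T _ => ?_⟩, hlim.1, fun n T => ?_⟩
  · obtain ⟨a, ha⟩ := hlim.2 T.monomial
    refine ⟨a, ?_⟩
    simp only [h1]
    exact ha
  · simpa only [h1, h2] using hconc n fun i => (T i).monomial
  · apply isBigO_one_growth
    choose a ha using fun i => hlim.2 (T i).monomial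
    -- Concentration and convergence of each mean make the mean of the product converge, hence
    -- bounded.
    have h3 := (hconc n fun i => (T i).monomial).add (tendsto_finsetProd Finset.univ fun i _ => ha i)
    simp only [sub_add_cancel] at h3
    simp only [h2]
    exact h3.isBigO_one ℝ


/-! ### Balls in colored graphs and local counts. -/

namespace ColoredGraph

variable {p : ℕ} {V W : Type*}

theorem mem_ball_self (G : ColoredGraph p V) (v : V) (r : ℕ) : v ∈ G.ball v r := by
  simp [ball]

theorem under_adj_or_eq {G : ColoredGraph p V} {j : Fin p} {v w : V} (h : G.Adj j v w) :
    v = w ∨ G.under.Adj v w := by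
  by_cases hvw : v = w
  · exact .inl hvw
  · exact .inr ((SimpleGraph.fromRel_adj _ _ _).2 ⟨hvw, .inl ⟨j, h⟩⟩)

theorem starVal_adjMatrix {N : ℕ} (G : ColoredGraph p (Fin N)) (x : Fin p × Bool) (k l : Fin N) :
    starVal G.adjMatrix x k l =
      open scoped Classical in if (if x.2 then G.Adj x.1 l k else G.Adj x.1 k l) then 1 else 0 := by
  obtain ⟨j, b⟩ := x
  unfold starVal adjMatrix
  cases b
  · by_cases h : G.Adj j k l <;> simp [h]
  · by_cases h : G.Adj j l k <;> simp [h, Matrix.conjTranspose_apply]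

theorem edist_le_one_of_starVal_ne_zero {N : ℕ} {G : ColoredGraph p (Fin N)} {x : Fin p × Bool}
    {k l : Fin N} (h : starVal G.adjMatrix x k l ≠ 0) : G.under.edist k l ≤ 1 := by
  rw [starVal_adjMatrix] at h
  have h1 : k = l ∨ G.under.Adj k l := by
    by_cases hx : x.2
    · simp only [hx, if_true, ne_eq, ite_eq_right_iff, one_ne_zero, imp_false, not_not] at h
      rcases under_adj_or_eq h with h | h
      · exact .inl h.symm
      · exact .inr h.symm
    · simp only [hx, Bool.false_eq_true, if_false, ne_eq, ite_eq_right_iff, one_ne_zero, imp_false,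
        not_not] at h
      exact under_adj_or_eq h
  rcases h1 with rfl | h1
  · simp
  · simpa using h1.toWalk.edist_le

theorem BallIso.of_common {V' W' : Type*} {G : ColoredGraph p V} {G' : ColoredGraph p V'} {v : V}
    {v' : V'} {r : ℕ} {H : ColoredGraph p W} {o : W} {H' : ColoredGraph p W'} {o' : W'}
    (h₁ : G.BallIso v r H o) (h₂ : G.BallIso v r H' o') (h : G'.BallIso v' r H o) :
    G'.BallIso v' r H' o' := by
  obtain ⟨f, hf, hf'⟩ := h₁
  obtain ⟨g, hg, hg'⟩ := h₂
  obtain ⟨e, he, he'⟩ := h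
  refine ⟨(e.trans f.symm).trans g, fun x hx => ?_, fun j x y => ?_⟩
  · have : f.symm o = ⟨v, G.mem_ball_self v r⟩ := by rw [Equiv.symm_apply_eq, hf _ rfl]
    simp [he x hx, this, hg]
  · simp [he', ← hg', hf']

theorem exists_ballIso {N : ℕ} (G : ColoredGraph p (Fin N)) (v : Fin N) (r : ℕ) :
    ∃ (H : ColoredGraph p (Fin (G.ball v r).ncard)) (o : Fin (G.ball v r).ncard),
      G.BallIso v r H o := by
  let f : G.ball v r ≃ Fin (G.ball v r).ncard := Finite.equivFin _
  refine ⟨⟨fun j a b => G.Adj j (f.symm a) (f.symm b)⟩, f ⟨v, G.mem_ball_self v r⟩, f,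
    fun x hx => ?_, ?_⟩
  · exact congrArg f (Subtype.ext hx)
  · simp

/-- A ball of radius `r + 1` is the center together with balls of radius `r` around at most `D`
neighbors. -/
theorem exists_ncard_ball_le (p D r : ℕ) : ∃ M : ℕ, ∀ (N : ℕ) (G : ColoredGraph p (Fin N)),
    G.DegreeLE D → ∀ v, (G.ball v r).ncard ≤ M := by
  classical
  induction r with
  | zero =>
    refine ⟨1, fun N G _ v => ?_⟩
    have : G.ball v 0 = {v} := by
      ext w
      change G.under.edist v w ≤ ((0 : ℕ) : ℕ∞) ↔ w = v
      rw [Nat.cast_zero, nonpos_iff_eq_zero, SimpleGraph.edist_eq_zero_iff, eq_comm]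
    simp [this]
  | succ r ih =>
    obtain ⟨M, hM⟩ := ih
    refine ⟨D * M + 1, fun N G hG v => ?_⟩
    have hsub : G.ball v (r + 1) ⊆ (((G.under.neighborSet v).toFinset.biUnion
        fun u => (G.ball u r).toFinset) ∪ {v} : Finset (Fin N)) := by
      intro w hw
      have hw' : G.under.edist v w ≤ ((r + 1 : ℕ) : ℕ∞) := hw
      obtain ⟨q, hq⟩ := SimpleGraph.exists_walk_of_edist_ne_top
        (ne_top_of_le_ne_top (ENat.natCast_ne_top _) hw')
      rw [← hq, Nat.cast_le] at hw'
      cases q with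
      | nil => simp
      | cons ha q =>
        rename_i u
        have h1 : G.under.edist u w ≤ (r : ℕ∞) :=
          q.edist_le.trans (by exact_mod_cast Nat.le_of_succ_le_succ (by simpa using hw'))
        have h2 : w ∈ G.ball u r := h1
        simp only [Finset.coe_union, Finset.coe_biUnion, Set.mem_union, Set.mem_iUnion]
        exact .inl ⟨u, by simpa using ha, by simpa using h2⟩
    refine (Set.ncard_le_ncard hsub (Finset.finite_toSet _)).trans ?_
    rw [Set.ncard_coe_finset]
    refine (Finset.card_union_le _ _).trans ?_
    rw [Finset.card_singleton]
    refine Nat.add_le_add_right ((Finset.card_biUnion_le_card_mul _ _ M fun u _ => ?_).trans ?_) 1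
    · rw [← Set.ncard_eq_toFinset_card']
      exact hM N G hG u
    · rw [← Set.ncard_eq_toFinset_card']
      exact Nat.mul_le_mul_right _ (hG v).2

instance {N : ℕ} : Finite (ColoredGraph p (Fin N)) :=
  Finite.of_injective ColoredGraph.Adj fun G G' h => by cases G; cases G'; congr

end ColoredGraph

namespace StarTestGraph

variable {p : ℕ} (T : StarTestGraph p)

/-- A vertex of the test graph. -/
noncomputable def root : Fin T.nV := T.connected.nonempty.some

open scoped Classical in
/-- The number of homomorphisms of the test graph in a colored graph, with a given value at the
root. -/
noncomputable def rootedCount {N : ℕ} (G : ColoredGraph p (Fin N)) (v : Fin N) : ℂ :=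
  ∑ φ : Fin T.nV → Fin N, if φ T.root = v then
    ∏ e : Fin T.nE, starVal G.adjMatrix (T.label e) (φ (T.src e)) (φ (T.tgt e)) else 0

theorem trace_adjMatrix {N : ℕ} (G : ColoredGraph p (Fin N)) :
    T.trace G.adjMatrix = (N : ℂ)⁻¹ * ∑ v, T.rootedCount G v := by
  unfold trace rootedCount
  rw [Finset.sum_comm]
  simp

/-- A nonzero product means that `φ` sends edges to edges or to equal vertices, so it does not
increase distances; a path in `T` has fewer than `T.nV` edges. -/
theorem mem_ball_of_prod_ne_zero {N : ℕ} {G : ColoredGraph p (Fin N)} {φ : Fin T.nV → Fin N}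
    (h : ∏ e : Fin T.nE, starVal G.adjMatrix (T.label e) (φ (T.src e)) (φ (T.tgt e)) ≠ 0)
    (w : Fin T.nV) : φ w ∈ G.ball (φ T.root) T.nV := by
  have key : ∀ (a b : Fin T.nV) (q : (T.spanBy Set.univ).Walk a b),
      G.under.edist (φ a) (φ b) ≤ (q.length : ℕ∞) := by
    intro a b q
    induction q with
    | nil => simp
    | cons ha q ih =>
      rename_i a b c
      have h1 : G.under.edist (φ a) (φ b) ≤ 1 := by
        obtain ⟨-, ⟨e, -, rfl, rfl⟩ | ⟨e, -, rfl, rfl⟩⟩ := T.spanBy_adj.1 ha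
        · exact ColoredGraph.edist_le_one_of_starVal_ne_zero
            (Finset.prod_ne_zero_iff.1 h e (Finset.mem_univ e))
        · rw [SimpleGraph.edist_comm]
          exact ColoredGraph.edist_le_one_of_starVal_ne_zero
            (Finset.prod_ne_zero_iff.1 h e (Finset.mem_univ e))
      refine SimpleGraph.edist_triangle.trans ((add_le_add h1 ih).trans (le_of_eq ?_))
      simp [add_comm]
  obtain ⟨q, hq⟩ := (T.spanBy_univ_connected.preconnected T.root w).exists_isPath
  refine (key _ _ q).trans ?_
  exact_mod_cast (hq.length_lt.le.trans (by simp))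

/-- The contributing labellings stay inside the ball, so the isomorphism carries them to labellings
in `H`. -/
theorem rootedCount_eq_of_ballIso {N m : ℕ} {G : ColoredGraph p (Fin N)} {v : Fin N}
    {H : ColoredGraph p (Fin m)} {o : Fin m} (h : G.BallIso v T.nV H o) :
    T.rootedCount G v = T.rootedCount H o := by
  obtain ⟨f, hf, hadj⟩ := h
  symm
  refine Fintype.sum_of_injective (fun ψ : Fin T.nV → Fin m => fun w => (f.symm (ψ w) : Fin N))
    ?_ _ _ ?_ ?_
  · intro ψ ψ' h
    ext1 w
    exact f.symm.injective (Subtype.ext (congrFun h w))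
  · intro φ hφ
    by_contra hne
    obtain ⟨h1, h2⟩ := ite_ne_right_iff.1 hne
    have h3 := T.mem_ball_of_prod_ne_zero h2
    rw [h1] at h3
    exact hφ ⟨fun w => f ⟨φ w, h3 w⟩, by simp⟩
  · intro ψ
    have h1 : ((f.symm (ψ T.root) : Fin N) = v) ↔ ψ T.root = o := by
      constructor
      · intro h
        simpa using hf _ h
      · intro h
        rw [h, ← hf ⟨v, G.mem_ball_self v _⟩ rfl, Equiv.symm_apply_apply]
    have h2 : ∀ j a b, G.Adj j (f.symm a) (f.symm b) ↔ H.Adj j a b := fun j a b => by simp [hadj]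
    have h3 : ∀ x a b, starVal G.adjMatrix x (f.symm a) (f.symm b) = starVal H.adjMatrix x a b := by
      rintro ⟨j, c⟩ a b
      rw [ColoredGraph.starVal_adjMatrix, ColoredGraph.starVal_adjMatrix]
      have h4 : (if c then G.Adj j (f.symm b) (f.symm a) else G.Adj j (f.symm a) (f.symm b)) ↔
          if c then H.Adj j b a else H.Adj j a b := by
        cases c
        · exact h2 j a b
        · exact h2 j b a
      classical exact if_congr h4 rfl rfl
    simp only [h1, h3]

end StarTestGraph

/-! ### Random graphs: mean traces as combinations of ball probabilities. -/

variable {p : ℕ} {Ω : ℕ → Type*} [∀ N, MeasurableSpace (Ω N)]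

/-- There are finitely many colored graphs on `Fin N`, so every property is a finite union of events
fixing all adjacencies. -/
theorem IsRandomGraph.measurableSet {Ω₀ : Type*} [MeasurableSpace Ω₀] {N : ℕ}
    {G : Ω₀ → ColoredGraph p (Fin N)} (hG : IsRandomGraph G) (S : ColoredGraph p (Fin N) → Prop) :
    MeasurableSet {ω | S (G ω)} := by
  have h1 : {ω | S (G ω)} = ⋃ g : {g // S g}, ⋂ (j : Fin p) (v : Fin N) (w : Fin N),
      {ω | (G ω).Adj j v w ↔ g.1.Adj j v w} := by
    ext ω
    simp only [Set.mem_ofPred_eq, Set.mem_iUnion, Set.mem_iInter]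
    constructor
    · intro h
      exact ⟨⟨G ω, h⟩, fun _ _ _ => Iff.rfl⟩
    · rintro ⟨⟨g, hg⟩, h⟩
      have : G ω = g := by
        cases hω : G ω
        cases g
        rw [hω] at h
        congr
        ext j v w
        exact h j v w
      exact this ▸ hg
  rw [h1]
  refine MeasurableSet.iUnion fun g => MeasurableSet.iInter fun j => MeasurableSet.iInter fun v =>
    MeasurableSet.iInter fun w => ?_
  by_cases h : g.1.Adj j v w
  · simpa [h] using hG j v w
  · have h2 : {ω | (G ω).Adj j v w ↔ g.1.Adj j v w} = {ω | (G ω).Adj j v w}ᶜ := by ext; simp [h]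
    exact h2 ▸ (hG j v w).compl

theorem IsRandomGraph.measurable_adjMatrix {Ω₀ : Type*} [MeasurableSpace Ω₀] {N : ℕ}
    {G : Ω₀ → ColoredGraph p (Fin N)} (hG : IsRandomGraph G) (j : Fin p) (k l : Fin N) :
    Measurable fun ω => (G ω).adjMatrix j k l := by
  classical
  exact Measurable.ite (hG j k l) measurable_const measurable_const

/-- The rooted colored graphs on at most `M` vertices. -/
abbrev SmallGraph (p M : ℕ) : Type :=
  Σ m : Fin (M + 1), ColoredGraph p (Fin m) × Fin m

/-- Two rooted graphs are identified if they describe the same balls of radius `r`. -/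
def ballSetoid (p M r : ℕ) : Setoid (SmallGraph p M) where
  r H H' := ∀ (N : ℕ) (G : ColoredGraph p (Fin N)) (v : Fin N),
    G.BallIso v r H.2.1 H.2.2 ↔ G.BallIso v r H'.2.1 H'.2.2
  iseqv := ⟨fun _ _ _ _ => Iff.rfl, fun h N G v => (h N G v).symm,
    fun h h' N G v => (h N G v).trans (h' N G v)⟩

theorem exists_smallGraph_ballIso {M r N : ℕ} (G : ColoredGraph p (Fin N)) (v : Fin N)
    (h : (G.ball v r).ncard ≤ M) : ∃ i : SmallGraph p M, G.BallIso v r i.2.1 i.2.2 := by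
  obtain ⟨H, o, hH⟩ := G.exists_ballIso v r
  exact ⟨⟨⟨_, Nat.lt_succ_of_le h⟩, H, o⟩, hH⟩

/-- Two small graphs that describe one common ball describe the same balls, by
`ColoredGraph.BallIso.of_common`. Hence the classes partition the balls, and no ball is counted
twice in a sum over classes. -/
theorem existsUnique_ballIso {M r N : ℕ} (G : ColoredGraph p (Fin N)) (v : Fin N)
    (h : (G.ball v r).ncard ≤ M) :
    ∃! q : Quotient (ballSetoid p M r), G.BallIso v r q.out.2.1 q.out.2.2 := by
  obtain ⟨i, hH⟩ := exists_smallGraph_ballIso G v h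
  refine ⟨Quotient.mk (ballSetoid p M r) i, ?_, fun q hq => ?_⟩
  · exact (Quotient.mk_out (s := ballSetoid p M r) i N G v).2 hH
  · rw [← Quotient.out_eq q]
    exact Quotient.sound (s := ballSetoid p M r) fun N' G' v' =>
      ⟨fun h' => ColoredGraph.BallIso.of_common hq hH h',
        fun h' => ColoredGraph.BallIso.of_common hH hq h'⟩

variable (P : ∀ N, Measure (Ω N)) [∀ N, IsProbabilityMeasure (P N)]

theorem tendsto_integral_trace {G : ∀ N, Ω N → ColoredGraph p (Fin N)} {Ω₀ : Type*}
    [MeasurableSpace Ω₀] (P₀ : Measure Ω₀) (G₀ : Ω₀ → ColoredGraph p ℕ)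
    (hG : ∀ N, IsRandomGraph (G N)) {D : ℕ} (hD : ∀ N, ∀ᵐ ω ∂(P N), (G N ω).DegreeLE D)
    (hlim : WeakLocalConv P G P₀ G₀) (T : StarTestGraph p) :
    ∃ τ : ℂ, Tendsto (fun N => ∫ ω, T.trace (G N ω).adjMatrix ∂(P N)) atTop (𝓝 τ) := by
  classical
  obtain ⟨M, hM⟩ := ColoredGraph.exists_ncard_ball_le p D T.nV
  let Q := Quotient (ballSetoid p M T.nV)
  have : Fintype Q := Fintype.ofFinite Q
  let c : Q → ℂ := fun q => T.rootedCount q.out.2.1 q.out.2.2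
  have hcount : ∀ N (g : ColoredGraph p (Fin N)), g.DegreeLE D → ∀ v, T.rootedCount g v =
      ∑ q : Q, Set.indicator {g | g.BallIso v T.nV q.out.2.1 q.out.2.2} (fun _ => c q) g := by
    intro N g hg v
    obtain ⟨q, hq, huniq⟩ := existsUnique_ballIso g v (hM N g hg v)
    rw [Finset.sum_eq_single q]
    · rw [Set.indicator_of_mem (by exact hq)]
      exact T.rootedCount_eq_of_ballIso hq
    · intro q' _ hne
      refine Set.indicator_of_notMem ?_ _
      exact fun h => hne (huniq q' h)
    · simp
  -- The count is constant on each class, so its mean is a fixed finite combination of the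
  -- quantities that weak local convergence controls.
  have hint : ∀ N, ∫ ω, T.trace (G N ω).adjMatrix ∂(P N) = ∑ q : Q, c q *
      (((N : ℝ)⁻¹ * ∑ v : Fin N,
        (P N).real {ω | (G N ω).BallIso v T.nV q.out.2.1 q.out.2.2} : ℝ) : ℂ) := by
    intro N
    have hms : ∀ (v : Fin N) (q : Q), MeasurableSet
        {ω | (G N ω).BallIso v T.nV q.out.2.1 q.out.2.2} := fun v q =>
      (hG N).measurableSet fun g => g.BallIso v T.nV q.out.2.1 q.out.2.2
    have h1 : ∀ᵐ ω ∂(P N), T.trace (G N ω).adjMatrix = (N : ℂ)⁻¹ * ∑ v, ∑ q : Q,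
        Set.indicator {ω | (G N ω).BallIso v T.nV q.out.2.1 q.out.2.2} (fun _ => c q) ω := by
      filter_upwards [hD N] with ω hω
      rw [T.trace_adjMatrix]
      simp only [hcount N _ hω]
      rfl
    have hi : ∀ (v : Fin N) (q : Q), Integrable
        (Set.indicator {ω | (G N ω).BallIso v T.nV q.out.2.1 q.out.2.2} fun _ => c q) (P N) :=
      fun v q => (integrable_const _).indicator (hms v q)
    rw [integral_congr_ae h1, integral_const_mul, integral_finsetSum _ fun v _ =>
      integrable_finsetSum _ fun q _ => hi v q]
    simp only [integral_finsetSum _ fun q _ => hi _ q, integral_indicator_const _ (hms _ _)]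
    rw [Finset.sum_comm, Finset.mul_sum]
    refine Finset.sum_congr rfl fun q _ => ?_
    push_cast
    simp only [Complex.real_smul, Finset.mul_sum]
    refine Finset.sum_congr rfl fun v _ => ?_
    ring
  simp only [hint]
  exact ⟨_, tendsto_finsetSum _ fun q _ => tendsto_const_nhds.mul
    ((Complex.continuous_ofReal.tendsto _).comp (hlim T.nV _ q.out.2.1 q.out.2.2))⟩

/-- Only finitely many values of the rooted count can occur; the sum of their norms dominates each
of them, and hence their average. -/
theorem exists_norm_trace_le (D : ℕ) (T : StarTestGraph p) : ∃ B : ℝ, ∀ (N : ℕ)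
    (G : ColoredGraph p (Fin N)), G.DegreeLE D → ‖T.trace G.adjMatrix‖ ≤ B := by
  classical
  obtain ⟨M, hM⟩ := ColoredGraph.exists_ncard_ball_le p D T.nV
  have : Fintype (SmallGraph p M) := Fintype.ofFinite _
  refine ⟨∑ i : SmallGraph p M, ‖T.rootedCount i.2.1 i.2.2‖, fun N G hG => ?_⟩
  rw [T.trace_adjMatrix, norm_mul, norm_inv, Complex.norm_natCast]
  have h : ‖∑ v, T.rootedCount G v‖ ≤
      N * ∑ i : SmallGraph p M, ‖T.rootedCount i.2.1 i.2.2‖ := by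
    refine (norm_sum_le_of_le (f := fun v => T.rootedCount G v)
      (n := fun _ => ∑ i : SmallGraph p M, ‖T.rootedCount i.2.1 i.2.2‖) _ fun v _ => ?_).trans ?_
    · obtain ⟨i, hi⟩ := exists_smallGraph_ballIso G v (hM N G hG v)
      rw [T.rootedCount_eq_of_ballIso hi]
      exact Finset.single_le_sum (f := fun i : SmallGraph p M => ‖T.rootedCount i.2.1 i.2.2‖)
        (fun _ _ => norm_nonneg _) (Finset.mem_univ i)
    · simp
  rcases N.eq_zero_or_pos with rfl | hN
  · simp only [Nat.cast_zero, inv_zero, zero_mul]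
    exact Finset.sum_nonneg fun _ _ => norm_nonneg _
  · rwa [inv_mul_le_iff₀ (by exact_mod_cast hN)]

theorem bounded_degree_graphs (G : ∀ N, Ω N → ColoredGraph p (Fin N)) {Ω₀ : Type*}
    [MeasurableSpace Ω₀] (P₀ : Measure Ω₀) (G₀ : Ω₀ → ColoredGraph p ℕ)
    (hG : ∀ N, IsRandomGraph (G N)) (hD : ∃ D : ℕ, ∀ N, ∀ᵐ ω ∂(P N), (G N ω).DegreeLE D)
    (hlim : WeakLocalConv P G P₀ G₀) :
    ConvTraffics P (fun N j ω => (G N ω).adjMatrix j) ∧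
      GrowthControl P (fun N j ω => (G N ω).adjMatrix j) := by
  obtain ⟨D, hD⟩ := hD
  have hfm : ∀ N, FiniteMoments P (fun N j ω => (G N ω).adjMatrix j) N := by
    intro N
    refine finiteMoments_of_bounded P (hG N).measurable_adjMatrix (C := 1) fun j =>
      .of_forall fun ω k l => ?_
    unfold ColoredGraph.adjMatrix
    rw [Matrix.of_apply]
    split_ifs <;> simp
  refine ⟨⟨fun n => hfm _, fun T _ => tendsto_integral_trace P P₀ G₀ hG hD hlim T⟩, hfm,
    fun n T => isBigO_one_growth n T ?_⟩
  choose B hB using fun i => exists_norm_trace_le D (T i)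
  refine IsBigO.of_bound (∏ i, B i) (.of_forall fun N => ?_)
  have h1 : ∀ᵐ ω ∂(P N), ‖∏ i, randTrace (fun N j ω => (G N ω).adjMatrix j) (T i) N ω‖ ≤
      ∏ i, B i := by
    filter_upwards [hD N] with ω hω
    rw [norm_prod]
    exact Finset.prod_le_prod (fun _ _ => norm_nonneg _) fun i _ => hB i N _ hω
  simpa using norm_integral_le_of_norm_le_const h1

end TrafficModels

theorem proposition2p2 (p : ℕ) {Ω : ℕ → Type*} [∀ N, MeasurableSpace (Ω N)]
    (P : ∀ N, Measure (Ω N)) [∀ N, IsProbabilityMeasure (P N)] :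
    -- (1) matrices uniformly bounded in operator norm
    (∀ Y : TrafficModels.RandomFamily p Ω,
      (∀ N j k l, Measurable (fun ω => Y N j ω k l)) →
      (∃ C : ℝ, ∀ N j, ∀ᵐ ω ∂(P N), ‖Matrix.toEuclideanCLM (𝕜 := ℂ) (Y N j ω)‖ ≤ C) →
      (∃ φ : ℕ → ℕ, StrictMono φ ∧ TrafficModels.ConvTrafficsAlong P Y φ) ∧
        TrafficModels.GrowthControl P Y) ∧
    -- (2) diagonal matrices
    (∀ D : TrafficModels.RandomFamily p Ω,
      (∀ N j, ∀ᵐ ω ∂(P N), (D N j ω).IsDiag) →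
      TrafficModels.HasLimitStarDistribution P D →
      (∀ (n : ℕ) (Q : Fin n → TrafficModels.StarPoly p),
        Tendsto (fun N =>
          (∫ ω, ∏ i, TrafficModels.polyTrace (Q i) (fun j => D N j ω) ∂(P N))
            - ∏ i, ∫ ω, TrafficModels.polyTrace (Q i) (fun j => D N j ω) ∂(P N))
          atTop (𝓝 0)) →
      TrafficModels.ConvTraffics P D ∧ TrafficModels.Concentration P D ∧
        TrafficModels.GrowthControl P D) ∧
    -- (3) adjacency matrices of colored graphs with bounded degree
    (∀ (G : ∀ N, Ω N → TrafficModels.ColoredGraph p (Fin N))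
      {Ω₀ : Type*} [MeasurableSpace Ω₀] (P₀ : Measure Ω₀) [IsProbabilityMeasure P₀]
      (G₀ : Ω₀ → TrafficModels.ColoredGraph p ℕ),
      (∀ N, TrafficModels.IsRandomGraph (G N)) →
      (∃ D : ℕ, ∀ N, ∀ᵐ ω ∂(P N), (G N ω).DegreeLE D) →
      TrafficModels.IsRandomGraph G₀ →
      (∀ᵐ ω ∂P₀, (G₀ ω).IsLocallyFinite) →
      TrafficModels.WeakLocalConv P G P₀ G₀ →
      TrafficModels.ConvTraffics P (fun N j ω => (G N ω).adjMatrix j) ∧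
        (TrafficModels.Concentration P (fun N j ω => (G N ω).adjMatrix j) →
          TrafficModels.GrowthControl P (fun N j ω => (G N ω).adjMatrix j))) := by
  refine ⟨fun Y hm hC => TrafficModels.bounded_operator_norm P Y hm hC,
    fun D hdiag hlim hconc => TrafficModels.diagonal_matrices P D hdiag hlim hconc, ?_⟩
  intro G Ω₀ _ P₀ _ G₀ hG hD _ _ hlim
  obtain ⟨h₁, h₂⟩ := TrafficModels.bounded_degree_graphs P G P₀ G₀ hG hD hlim
  exact ⟨h₁, fun _ => h₂⟩
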